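/- Let $n\ge 1$ be an integer and let $e^{it\Delta}$ denote the free Schrödinger flow on $\mathbb{R}^n$, i.e. $u(t)=e^{it\Delta}u_0$ solves $i\partial_t u+\Delta u=0$, $u(0)=u_0$ (equivalently, $e^{it\Delta}$ is the Fourier multiplier with symbol $e^{-it|\xi|^2}$ for $\hat f(\xi)=\int e^{-ix\cdot\xi}f(x)\,dx$). Write $1/\infty=0$, write $p'$ for the conjugate exponent of $p\in[1,\infty]$ ($\frac1p+\frac1{p'}=1$), and $\|f\|_p=\|f\|_{L^p(\mathbb{R}^n)}$ for $p\in(0,\infty]$. (i) Let $b_1,b_2\in(0,\infty)$ and $a_1,a_2,k_1,k_2\in(0,\infty]$, put $r_i=\frac{n}{n/a_i+b_i}$ and $\sigma_i=\frac1{a_i}+\frac{b_i}{n}-\frac1{k_i}$, and suppose that $r_i<\min\{2,k_i\}$ for $i=1,2$, that $k_1<r_2'$ whenever $r_2\ge1$, and that $k_2<r_1'$ whenever $r_1\ge1$. Then there is a constant $C>0$, depending only on $n,a_1,a_2,b_1,b_2,k_1,k_2$, such that for all nonzero Schwartz functions $u_0:\mathbb{R}^n\to\mathbb{C}$, all $t\in\mathbb{R}\setminus\{0\}$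 and all $x_0,x_1\in\mathbb{R}^n$, $$\left(\frac{\big\||x-x_0|^{b_1}u_0\big\|_{a_1}}{\|u_0\|_{k_1}}\right)^{\sigma_2}\left(\frac{\big\||x-x_1|^{b_2}e^{it\Delta}u_0\big\|_{a_2}}{\|e^{it\Delta}u_0\|_{k_2}}\right)^{\sigma_1}\ \ge\ C\,|t|^{\,n\sigma_1\sigma_2}.$$ (ii) Let $a\in(0,\infty]$ and $b\in(0,\infty)$ satisfy $\frac{n}{n/a+b}<2$, and let $u_0$ be a nonzero Schwartz function on $\mathbb{R}^n$. Then there is a constant $C>0$, depending only on $u_0,n,a,b$, such that for all $t\in\mathbb{R}\setminus\{0\}$ and all $x_0\in\mathbb{R}^n$, $$\big\||x-x_0|^{b}e^{it\Delta}u_0\big\|_{a}\ \ge\ C\,|t|^{\,n\left(\frac1a+\frac bn-\frac12\right)}.$$ -/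

import Mathlib

open MeasureTheory
open scoped ENNReal FourierTransform SchwartzMap

/-- The free Schrödinger flow `e^{itΔ} u₀`, i.e. the solution at time `t` of `i ∂ₜu + Δu = 0`,
`u(0) = u₀`, as a Fourier multiplier. Since `𝓕 f ξ = ∫ exp (-2πi⟪x, ξ⟫) f x dx`, the operator `Δ`
has the symbol `-4π²‖ξ‖²`. -/
noncomputable def schrodingerFlow {n : ℕ} (t : ℝ) (u₀ : 𝓢(EuclideanSpace ℝ (Fin n), ℂ)) :
    EuclideanSpace ℝ (Fin n) → ℂ :=
  𝓕⁻ (fun ξ : EuclideanSpace ℝ (Fin n) =>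
    Complex.exp (-(4 * (Real.pi : ℂ) ^ 2 * Complex.I * (t : ℂ) * ((‖ξ‖ ^ 2 : ℝ) : ℂ))) *
      (𝓕 (u₀ : EuclideanSpace ℝ (Fin n) → ℂ)) ξ)

/-- The moment `‖ |x - x₀|^b f ‖_{L^a(ℝⁿ)}` for `a ∈ (0, ∞]`. -/
noncomputable def moment {n : ℕ} (a : ℝ≥0∞) (b : ℝ) (x₀ : EuclideanSpace ℝ (Fin n))
    (f : EuclideanSpace ℝ (Fin n) → ℂ) : ℝ≥0∞ :=
  eLpNorm (fun x => ((‖x - x₀‖ ^ b : ℝ) : ℂ) * f x) a volume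

/-- The exponent `n / (n / a + b)`, with `n / ∞ = 0`. -/
noncomputable def critExponent (n : ℕ) (a : ℝ≥0∞) (b : ℝ) : ℝ≥0∞ :=
  (n : ℝ≥0∞) / ((n : ℝ≥0∞) / a + ENNReal.ofReal b)

/-- The real number `1 / a + b / n - 1 / k`, with `1 / ∞ = 0`. -/
noncomputable def momentGap (n : ℕ) (a : ℝ≥0∞) (b : ℝ) (k : ℝ≥0∞) : ℝ :=
  a⁻¹.toReal + b / n - k⁻¹.toReal

/-!
The argument works with the norms of a function as a function of the reciprocal exponent,
`recipNorm f s = ‖f‖_{1/s}`, and rests on three facts. Put `d = n`, `α = 1/a`, `κ = 1/k` and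
`ρ = α + b/d`, so that `1/ρ` is the critical exponent and `σ = ρ - κ`.

* Convexity. `s ↦ log ‖u‖_{1/s}` is convex on `[0, ∞)` (`convexOn_log_recipNorm`), also for
  exponents below one.
* Interpolation with a moment. For `κ, α < s < ρ`, Hölder's inequality inside and outside a ball of
  radius `R` bounds `‖u‖_{1/s}` by `‖u‖_{1/κ}` and the moment `M`; optimizing in `R` gives
  `log ‖u‖_{1/s} - log ‖u‖_{1/κ} ≤ C + (s - κ)/σ * (log M - log ‖u‖_{1/κ})`. As slopes of a convex
  function increase, `(M / ‖u‖_{1/κ}) ^ (1/σ)` dominates, up to a constant,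
  `(‖u‖_{1/s} / ‖u‖_{1/s'}) ^ (1/(s - s'))` for all `s' < s < ρ` with `s' ≤ κ` (`exists_le_moment_div`).
* Decay. The flow is an isometry of `L²` and maps `L¹` to `L^∞` with norm `(4π|t|)^(-d/2)`, hence
  `‖e^{itΔ}u‖_{1/(1-s)} ≤ C |t|^(-d(s - 1/2)) ‖u‖_{1/s}` for `1/2 ≤ s ≤ 1`. The intermediate cases
  come from real interpolation, as the constant is irrelevant
  (`exists_recipNorm_map_one_sub_le`). The `L¹ → L^∞` bound follows from the Fourier transform of
  the Gaussians `exp (-(ε + 4π²it)|ξ|²)` as `ε → 0` (`norm_schrodingerPropagator_le`).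

For the uncertainty principle, the hypotheses other than `κᵢ < ρᵢ` say that there are
`s₁, s₂ ∈ (1/2, 1]` with `sᵢ < ρᵢ`, `1 - s₂ ≤ κ₁` and `1 - s₁ ≤ κ₂`. The moment of `u` is then bounded below by the slope of
`log ‖u‖` between `1 - s₂` and `s₁`, and that of `v = e^{itΔ}u` by the slope of `log ‖v‖` between
`1 - s₁` and `s₂`. Both intervals have length `s₁ + s₂ - 1`, and the sum of the two slopes is
controlled by the decay estimate from `u` to `v` at `s₁` and from `v` to `u` at `s₂`
(`exists_le_moment_div_rpow_mul`). For a fixed datum, `κ = 1/2` and the conservation of the `L²`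
norm give the growth of the moments (`exists_le_moment_schrodingerPropagator`).
-/

/-! ### Norms as functions of the reciprocal exponent -/

section LebesgueNorms

variable {E : Type*} [NormedAddCommGroup E] [InnerProductSpace ℝ E] [FiniteDimensional ℝ E]
  [MeasurableSpace E] [BorelSpace E]

/-- The quasi-norm `‖f‖_{1/s}`, as a function of the reciprocal exponent `s ∈ [0, ∞)`; the value
`s = 0` gives the supremum norm, as `0⁻¹ = ∞` in `ℝ≥0∞`. Negative `s` carry no meaning. -/
noncomputable def recipNorm (f : E → ℂ) (s : ℝ) : ℝ≥0∞ :=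
  eLpNorm f (ENNReal.ofReal s)⁻¹ volume

theorem recipNorm_inv_toReal (f : E → ℂ) {p : ℝ≥0∞} (hp : p ≠ 0) :
    recipNorm f p⁻¹.toReal = eLpNorm f p volume := by
  rw [recipNorm, ENNReal.ofReal_toReal (by simpa using hp), inv_inv]

theorem holderTriple_ofReal_inv {s t : ℝ} (hs : 0 ≤ s) (ht : 0 ≤ t) :
    ENNReal.HolderTriple (ENNReal.ofReal s)⁻¹ (ENNReal.ofReal t)⁻¹ (ENNReal.ofReal (s + t))⁻¹ :=
  ⟨by simp [ENNReal.ofReal_add hs ht]⟩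

/-- Lyapunov's inequality: `s ↦ ‖f‖_{1/s}` is logarithmically convex. -/
theorem recipNorm_le_rpow_mul_rpow {f : E → ℂ} (hf : AEStronglyMeasurable f volume) {s t θ η : ℝ}
    (hs : 0 ≤ s) (ht : 0 ≤ t) (hθ : 0 < θ) (hη : 0 < η) (h1 : θ + η = 1) :
    recipNorm f (θ * s + η * t) ≤ recipNorm f s ^ θ * recipNorm f t ^ η := by
  have := holderTriple_ofReal_inv (mul_nonneg hθ.le hs) (mul_nonneg hη.le ht)
  have key : ∀ {r c : ℝ}, 0 ≤ r → 0 < c →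
      eLpNorm (fun x => ‖f x‖ ^ c) (ENNReal.ofReal (c * r))⁻¹ volume = recipNorm f r ^ c := by
    intro r c hr hc
    rw [eLpNorm_norm_rpow f hc, recipNorm, ENNReal.ofReal_mul hc.le,
      ENNReal.mul_inv (Or.inl (by simpa using hc)) (Or.inl ENNReal.ofReal_ne_top), mul_comm,
      ← mul_assoc, ENNReal.mul_inv_cancel (by simpa using hc) ENNReal.ofReal_ne_top, one_mul]
  have H := eLpNorm_smul_le_mul_eLpNorm (μ := (volume : Measure E))
    (p := (ENNReal.ofReal (θ * s))⁻¹) (q := (ENNReal.ofReal (η * t))⁻¹)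
    (r := (ENNReal.ofReal (θ * s + η * t))⁻¹)
    (f := fun x => ‖f x‖ ^ η) (φ := fun x => ‖f x‖ ^ θ)
    (hf.norm.aemeasurable.pow_const η).aestronglyMeasurable
    (hf.norm.aemeasurable.pow_const θ).aestronglyMeasurable
  rw [key hs hθ, key ht hη] at H
  refine le_trans (le_of_eq ?_) H
  rw [recipNorm, ← eLpNorm_norm]
  congr 1
  ext x
  simp only [Pi.smul_apply', smul_eq_mul]
  rw [← Real.rpow_add' (norm_nonneg _) (by rw [h1]; exact one_ne_zero), h1, Real.rpow_one]

/-- The exponent `1/s` norm is controlled by the `1/κ` norm on the unit ball and by the weighted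
`1/α` norm outside of it; `s < α + b/d` makes `‖x‖ ^ (-b)` integrable enough at infinity. -/
theorem exists_recipNorm_le_add {s κ α b : ℝ} (hκ : 0 ≤ κ) (hα : 0 ≤ α) (hb : 0 < b)
    (hκs : κ < s) (hαs : α < s) (hs : Module.finrank ℝ E * (s - α) < b) :
    ∃ C : ℝ≥0∞, C ≠ ∞ ∧ ∀ f : E → ℂ, AEStronglyMeasurable f volume →
      recipNorm f s ≤
        C * (recipNorm f κ + recipNorm (fun x => ((‖x‖ ^ b : ℝ) : ℂ) * f x) α) := by
  set B : Set E := Metric.closedBall 0 1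
  have hB : MeasurableSet B := Metric.isClosed_closedBall.measurableSet
  set χ : E → ℂ := B.indicator 1
  set w : E → ℂ := fun x => (((1 + ‖x‖) ^ (-b) : ℝ) : ℂ)
  set C₁ := eLpNorm χ (ENNReal.ofReal (s - κ))⁻¹ volume
  set C₂ := eLpNorm w (ENNReal.ofReal (s - α))⁻¹ volume
  have hχ : AEStronglyMeasurable χ volume :=
    (stronglyMeasurable_one.indicator hB).aestronglyMeasurable
  have hw : AEStronglyMeasurable w volume := by
    refine Continuous.aestronglyMeasurable ?_
    refine Complex.continuous_ofReal.comp ?_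
    exact (continuous_const.add continuous_norm).rpow_const
      (fun x => Or.inl (by
        have : 0 < 1 + ‖x‖ := by positivity
        exact this.ne'))
  have hC₁ : C₁ ≠ ∞ := by
    refine (memLp_indicator_const _ hB (1 : ℂ) (Or.inr ?_)).eLpNorm_ne_top
    exact (isCompact_closedBall (0 : E) 1).measure_lt_top.ne
  have hC₂ : C₂ ≠ ∞ := by
    have h1 : 0 < s - α := by linarith
    have hp : (ENNReal.ofReal (s - α))⁻¹ ≠ 0 := by simp
    have hp' : (ENNReal.ofReal (s - α))⁻¹ ≠ ∞ := by simpa using h1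
    refine ((eLpNorm_lt_top_iff_lintegral_rpow_enorm_lt_top hp hp').2 ?_).ne
    have h2 : (Module.finrank ℝ E : ℝ) < b * (s - α)⁻¹ := by
      rw [← div_eq_mul_inv, lt_div_iff₀ h1]; exact hs
    refine lt_of_le_of_lt (le_of_eq ?_) (finite_integral_one_add_norm (μ := (volume : Measure E)) h2)
    refine lintegral_congr fun x => ?_
    have h3 : ‖w x‖ₑ = ENNReal.ofReal ((1 + ‖x‖) ^ (-b)) := by
      rw [← ofReal_norm]
      congr 1
      simp only [w, Complex.norm_real, Real.norm_eq_abs]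
      exact abs_of_nonneg (by positivity)
    rw [h3, ENNReal.toReal_inv, ENNReal.toReal_ofReal h1.le,
      ENNReal.ofReal_rpow_of_nonneg (by positivity) (by positivity), ← Real.rpow_mul (by positivity)]
    congr 2
    ring
  refine ⟨ENNReal.LpAddConst (ENNReal.ofReal s)⁻¹ * (C₁ + ENNReal.ofReal (2 ^ b) * C₂), ?_, ?_⟩
  · exact ENNReal.mul_ne_top (ENNReal.LpAddConst_lt_top _).ne
      (ENNReal.add_ne_top.2 ⟨hC₁, ENNReal.mul_ne_top ENNReal.ofReal_ne_top hC₂⟩)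
  intro f hf
  set g : E → ℂ := fun x => ((‖x‖ ^ b : ℝ) : ℂ) * f x
  have hg : AEStronglyMeasurable g volume := by
    refine AEStronglyMeasurable.mul (Continuous.aestronglyMeasurable ?_) hf
    exact Complex.continuous_ofReal.comp (continuous_norm.rpow_const fun x => Or.inr hb.le)
  have := holderTriple_ofReal_inv (sub_nonneg.2 hκs.le) hκ
  have := holderTriple_ofReal_inv (sub_nonneg.2 hαs.le) hα
  have hin : eLpNorm (B.indicator f) (ENNReal.ofReal s)⁻¹ volume ≤ C₁ * recipNorm f κ := by
    have H := eLpNorm_smul_le_mul_eLpNorm (μ := (volume : Measure E))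
      (p := (ENNReal.ofReal (s - κ))⁻¹) (q := (ENNReal.ofReal κ)⁻¹)
      (r := (ENNReal.ofReal (s - κ + κ))⁻¹) hf hχ
    rw [sub_add_cancel] at H
    refine le_trans (le_of_eq ?_) H
    congr 1
    ext x
    by_cases hx : x ∈ B <;> simp [χ, hx]
  have hout : eLpNorm (Bᶜ.indicator f) (ENNReal.ofReal s)⁻¹ volume ≤
      ENNReal.ofReal (2 ^ b) * C₂ * recipNorm g α := by
    have H := eLpNorm_smul_le_mul_eLpNorm (μ := (volume : Measure E))
      (p := (ENNReal.ofReal (s - α))⁻¹) (q := (ENNReal.ofReal α)⁻¹)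
      (r := (ENNReal.ofReal (s - α + α))⁻¹) hg hw
    rw [sub_add_cancel] at H
    rw [mul_assoc]
    refine le_trans ?_ (mul_le_mul_right H _)
    refine eLpNorm_le_mul_eLpNorm_of_ae_le_mul (ae_of_all _ fun x => ?_) _
    by_cases hx : x ∈ B
    · rw [Set.indicator_of_notMem (Set.notMem_compl_iff.2 hx), norm_zero]
      positivity
    · have hx1 : 1 < ‖x‖ := by simpa [B] using hx
      rw [Set.indicator_of_mem (by simpa using hx)]
      have : (1 : ℝ) ≤ 2 ^ b * ((1 + ‖x‖) ^ (-b) * ‖x‖ ^ b) := by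
        rw [Real.rpow_neg (by positivity), ← Real.inv_rpow (by positivity),
          ← Real.mul_rpow (by positivity) (by positivity),
          ← Real.mul_rpow (by positivity) (by positivity)]
        refine Real.one_le_rpow ?_ hb.le
        rw [inv_mul_eq_div, ← mul_div_assoc, le_div_iff₀ (by positivity)]
        linarith
      simp only [Pi.smul_apply', smul_eq_mul, norm_mul, w, g, Complex.norm_real, Real.norm_eq_abs]
      rw [abs_of_nonneg (a := (1 + ‖x‖) ^ (-b)) (by positivity),
        abs_of_nonneg (a := ‖x‖ ^ b) (by positivity)]
      calc ‖f x‖ = 1 * ‖f x‖ := (one_mul _).symm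
        _ ≤ 2 ^ b * ((1 + ‖x‖) ^ (-b) * ‖x‖ ^ b) * ‖f x‖ := by gcongr
        _ = _ := by ring
  calc recipNorm f s = eLpNorm (B.indicator f + Bᶜ.indicator f) (ENNReal.ofReal s)⁻¹ volume := by
        rw [Set.indicator_self_add_compl, recipNorm]
    _ ≤ ENNReal.LpAddConst (ENNReal.ofReal s)⁻¹ * (eLpNorm (B.indicator f) (ENNReal.ofReal s)⁻¹ volume +
          eLpNorm (Bᶜ.indicator f) (ENNReal.ofReal s)⁻¹ volume) :=
        eLpNorm_add_le' (hf.indicator hB) (hf.indicator hB.compl) _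
    _ ≤ ENNReal.LpAddConst (ENNReal.ofReal s)⁻¹ * (C₁ * recipNorm f κ +
          ENNReal.ofReal (2 ^ b) * C₂ * recipNorm g α) := by gcongr
    _ ≤ ENNReal.LpAddConst (ENNReal.ofReal s)⁻¹ *
          ((C₁ + ENNReal.ofReal (2 ^ b) * C₂) * (recipNorm f κ + recipNorm g α)) := by
        gcongr
        rw [mul_add]
        gcongr
        · exact le_self_add
        · exact le_add_self
    _ = _ := by rw [mul_assoc]

/-- The behaviour of the norms under an affine change of variables. -/
theorem recipNorm_comp_add_smul (f : E → ℂ) {s R : ℝ} (hs : 0 ≤ s) (hR : 0 < R) (c : E) :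
    recipNorm (fun x => f (c + R • x)) s =
      ENNReal.ofReal (R ^ (-(Module.finrank ℝ E * s))) * recipNorm f s := by
  have hR0 : R ≠ 0 := hR.ne'
  have e1 : MeasurableEmbedding (fun x : E => R • x) :=
    (Homeomorph.smulOfNeZero R hR0).measurableEmbedding
  have e2 : MeasurableEmbedding (fun x : E => c + x) := (Homeomorph.addLeft c).measurableEmbedding
  have h1 : recipNorm (fun x => f (c + R • x)) s =
      eLpNorm (fun x => f (c + x)) (ENNReal.ofReal s)⁻¹
        (Measure.map (fun x : E => R • x) volume) := by
    rw [e1.eLpNorm_map_measure]; rfl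
  have h2 : eLpNorm (fun x => f (c + x)) (ENNReal.ofReal s)⁻¹ volume = recipNorm f s := by
    rw [recipNorm]
    conv_rhs => rw [← map_add_left_eq_self (volume : Measure E) c, e2.eLpNorm_map_measure]
    rfl
  rw [h1, Measure.map_addHaar_smul volume hR0, eLpNorm_smul_measure_of_ne_zero (by simp [hR0]), h2,
    smul_eq_mul]
  congr 1
  rw [one_div, inv_inv, ENNReal.toReal_ofReal hs, abs_of_nonneg (by positivity),
    ENNReal.ofReal_rpow_of_nonneg (by positivity) hs, ← Real.rpow_natCast, ← Real.rpow_neg hR.le,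
    ← Real.rpow_mul hR.le]
  congr 2
  ring

end LebesgueNorms

/-! ### Interpolation between norms and moments -/

section MomentInequality

variable {E : Type*} [NormedAddCommGroup E] [InnerProductSpace ℝ E] [FiniteDimensional ℝ E]
  [MeasurableSpace E] [BorelSpace E]

theorem recipNorm_schwartz_ne_top (u : 𝓢(E, ℂ)) (s : ℝ) : recipNorm u s ≠ ∞ := by
  rw [recipNorm]
  exact (u.eLpNorm_lt_top (ENNReal.ofReal s)⁻¹ volume).ne

theorem recipNorm_schwartz_ne_zero {u : 𝓢(E, ℂ)} (hu : u ≠ 0) (s : ℝ) : recipNorm u s ≠ 0 := by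
  intro h
  rw [recipNorm, eLpNorm_eq_zero_iff u.continuous.aestronglyMeasurable (by simp)] at h
  refine hu (SchwartzMap.ext fun x => ?_)
  exact congrFun (Continuous.ae_eq_iff_eq volume u.continuous continuous_const |>.1 h) x

theorem toReal_recipNorm_pos {u : 𝓢(E, ℂ)} (hu : u ≠ 0) (s : ℝ) : 0 < (recipNorm u s).toReal :=
  ENNReal.toReal_pos (recipNorm_schwartz_ne_zero hu s) (recipNorm_schwartz_ne_top u s)

theorem recipNorm_weight_ne_zero [Nontrivial E] {u : 𝓢(E, ℂ)} (hu : u ≠ 0) (b : ℝ) (α : ℝ) (c : E) :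
    recipNorm (fun x => ((‖x - c‖ ^ b : ℝ) : ℂ) * u x) α ≠ 0 := by
  intro h
  have hm : Measurable fun x : E => ((‖x - c‖ ^ b : ℝ) : ℂ) := by fun_prop
  have hm' : AEStronglyMeasurable (fun x => ((‖x - c‖ ^ b : ℝ) : ℂ) * u x) volume :=
    hm.aestronglyMeasurable.mul u.continuous.aestronglyMeasurable
  rw [recipNorm, eLpNorm_eq_zero_iff hm' (by simp)] at h
  refine hu (SchwartzMap.ext fun x => ?_)
  refine congrFun (Continuous.ae_eq_iff_eq volume u.continuous continuous_const |>.1 ?_) x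
  filter_upwards [h, Measure.ae_ne volume c] with y hy hyc
  have : 0 < ‖y - c‖ := norm_pos_iff.2 (sub_ne_zero.2 hyc)
  have h2 : ((‖y - c‖ ^ b : ℝ) : ℂ) ≠ 0 := by exact_mod_cast (Real.rpow_pos_of_pos this b).ne'
  exact (mul_eq_zero.1 hy).resolve_left h2

/-- Lyapunov's inequality for a nonzero Schwartz function, all of whose norms are positive and
finite. -/
theorem convexOn_log_recipNorm {u : 𝓢(E, ℂ)} (hu : u ≠ 0) :
    ConvexOn ℝ (Set.Ici 0) fun s => Real.log (recipNorm u s).toReal := by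
  refine convexOn_iff_forall_pos.2 ⟨convex_Ici 0, ?_⟩
  intro s hs t ht θ η hθ hη h1
  have hs' := toReal_recipNorm_pos hu s
  have ht' := toReal_recipNorm_pos hu t
  have H := recipNorm_le_rpow_mul_rpow u.continuous.aestronglyMeasurable hs ht hθ hη h1
  have H' := ENNReal.toReal_mono (ENNReal.mul_ne_top
    (ENNReal.rpow_ne_top_of_nonneg hθ.le (recipNorm_schwartz_ne_top u s))
    (ENNReal.rpow_ne_top_of_nonneg hη.le (recipNorm_schwartz_ne_top u t))) H
  rw [ENNReal.toReal_mul, ← ENNReal.toReal_rpow, ← ENNReal.toReal_rpow] at H'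
  simp only [smul_eq_mul]
  rw [← Real.log_rpow hs', ← Real.log_rpow ht',
    ← Real.log_mul (Real.rpow_pos_of_pos hs' _).ne' (Real.rpow_pos_of_pos ht' _).ne']
  exact Real.log_le_log (toReal_recipNorm_pos hu _) H'

/-- `exists_recipNorm_le_add` rescaled to a ball of radius `R` around an arbitrary centre. -/
theorem exists_recipNorm_le_add_scaled {s κ α b : ℝ} (hκ : 0 ≤ κ) (hα : 0 ≤ α) (hb : 0 < b)
    (hκs : κ < s) (hαs : α < s) (hs : Module.finrank ℝ E * (s - α) < b) :
    ∃ C : ℝ, 0 < C ∧ ∀ (f : E → ℂ), AEStronglyMeasurable f volume → ∀ (c : E) (R : ℝ), 0 < R →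
      recipNorm f s ≤
        ENNReal.ofReal (C * R ^ (Module.finrank ℝ E * (s - κ))) * recipNorm f κ +
        ENNReal.ofReal (C * R ^ (Module.finrank ℝ E * (s - α) - b)) *
          recipNorm (fun x => ((‖x - c‖ ^ b : ℝ) : ℂ) * f x) α := by
  obtain ⟨C, hC, H⟩ := exists_recipNorm_le_add (E := E) hκ hα hb hκs hαs hs
  refine ⟨C.toReal + 1, by positivity, fun f hf c R hR => ?_⟩
  set d : ℝ := (Module.finrank ℝ E : ℝ)
  set h : E → ℂ := fun x => ((‖x - c‖ ^ b : ℝ) : ℂ) * f x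
  have hq : Measure.QuasiMeasurePreserving (fun x : E => c + R • x) volume volume := by
    have h1 : Measure.QuasiMeasurePreserving (fun x : E => R • x) volume volume := by
      refine ⟨by fun_prop, ?_⟩
      rw [Measure.map_addHaar_smul volume hR.ne']
      exact Measure.smul_absolutelyContinuous
    exact (measurePreserving_add_left volume c).quasiMeasurePreserving.comp h1
  have hv := H (fun x => f (c + R • x)) (hf.comp_quasiMeasurePreserving hq)
  have hw : (fun x : E => ((‖x‖ ^ b : ℝ) : ℂ) * f (c + R • x)) =
      ((R ^ (-b) : ℝ) : ℂ) • fun x => h (c + R • x) := by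
    ext x
    simp only [h, Pi.smul_apply, smul_eq_mul, add_sub_cancel_left, norm_smul, Real.norm_eq_abs,
      abs_of_pos hR]
    rw [Real.mul_rpow hR.le (norm_nonneg x), ← mul_assoc, ← Complex.ofReal_mul, ← mul_assoc,
      ← Real.rpow_add hR, neg_add_cancel, Real.rpow_zero, one_mul]
  have hw' : recipNorm (fun x : E => ((‖x‖ ^ b : ℝ) : ℂ) * f (c + R • x)) α =
      ENNReal.ofReal (R ^ (-b)) * (ENNReal.ofReal (R ^ (-(d * α))) * recipNorm h α) := by
    rw [hw, recipNorm, eLpNorm_const_smul]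
    congr 1
    · rw [← ofReal_norm, Complex.norm_real, Real.norm_eq_abs,
        abs_of_pos (Real.rpow_pos_of_pos hR _)]
    · exact recipNorm_comp_add_smul h hα hR c
  have hs0 : 0 ≤ s := by linarith
  rw [hw', recipNorm_comp_add_smul f hs0 hR, recipNorm_comp_add_smul f hκ hR] at hv
  have hCle : C ≤ ENNReal.ofReal (C.toReal + 1) := by
    rw [← ENNReal.toReal_le_toReal hC ENNReal.ofReal_ne_top,
      ENNReal.toReal_ofReal (by positivity)]
    linarith
  have hcancel : ENNReal.ofReal (R ^ (d * s)) * ENNReal.ofReal (R ^ (-(d * s))) = 1 := by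
    rw [← ENNReal.ofReal_mul (by positivity), ← Real.rpow_add hR]
    simp
  have e1 : R ^ (d * (s - κ)) = R ^ (d * s) * R ^ (-(d * κ)) := by
    rw [← Real.rpow_add hR]; ring_nf
  have e2 : R ^ (d * (s - α) - b) = R ^ (d * s) * (R ^ (-b) * R ^ (-(d * α))) := by
    rw [← Real.rpow_add hR, ← Real.rpow_add hR]; ring_nf
  calc recipNorm f s = ENNReal.ofReal (R ^ (d * s)) *
        (ENNReal.ofReal (R ^ (-(d * s))) * recipNorm f s) := by
        rw [← mul_assoc, hcancel, one_mul]
    _ ≤ ENNReal.ofReal (R ^ (d * s)) * (ENNReal.ofReal (C.toReal + 1) *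
        (ENNReal.ofReal (R ^ (-(d * κ))) * recipNorm f κ +
          ENNReal.ofReal (R ^ (-b)) * (ENNReal.ofReal (R ^ (-(d * α))) * recipNorm h α))) := by
        refine mul_le_mul_right (hv.trans (mul_le_mul_left hCle _)) _
    _ = _ := by
        rw [e1, e2]
        repeat rw [ENNReal.ofReal_mul (by positivity)]
        ring

/-- Interpolation between a norm and a moment, in logarithmic form. The radius that balances the
two terms of `exists_recipNorm_le_add_scaled` satisfies `R ^ d = (M / ‖u‖_{1/κ}) ^ (1 / σ)`. -/
theorem exists_log_recipNorm_sub_le [Nontrivial E] {s κ α b : ℝ} (hκ : 0 ≤ κ) (hα : 0 ≤ α)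
    (hb : 0 < b) (hκs : κ < s) (hαs : α < s) (hs : s < α + b / Module.finrank ℝ E) :
    ∃ C : ℝ, ∀ u : 𝓢(E, ℂ), u ≠ 0 → ∀ c : E,
      recipNorm (fun x => ((‖x - c‖ ^ b : ℝ) : ℂ) * u x) α ≠ ∞ →
      Real.log (recipNorm u s).toReal - Real.log (recipNorm u κ).toReal ≤
        C + (s - κ) / (α + b / Module.finrank ℝ E - κ) *
          (Real.log (recipNorm (fun x => ((‖x - c‖ ^ b : ℝ) : ℂ) * u x) α).toReal -
            Real.log (recipNorm u κ).toReal) := by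
  have hd : (0 : ℝ) < Module.finrank ℝ E := by exact_mod_cast Module.finrank_pos
  set d : ℝ := (Module.finrank ℝ E : ℝ)
  have hs' : d * (s - α) < b := by
    have : s - α < b / d := by linarith
    rw [lt_div_iff₀ hd] at this
    linarith
  obtain ⟨C, hC, H⟩ := exists_recipNorm_le_add_scaled (E := E) hκ hα hb hκs hαs hs'
  refine ⟨Real.log (2 * C), fun u hu c hM => ?_⟩
  have hM0 := recipNorm_weight_ne_zero hu b α c
  have Hu := H u u.continuous.aestronglyMeasurable c
  set M := recipNorm (fun x => ((‖x - c‖ ^ b : ℝ) : ℂ) * u x) α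
  have hMpos : 0 < M.toReal := ENNReal.toReal_pos hM0 hM
  set m := M.toReal
  have hK := toReal_recipNorm_pos hu κ
  have hS := toReal_recipNorm_pos hu s
  have hKt := recipNorm_schwartz_ne_top u κ
  set K := (recipNorm u κ).toReal with hKdef
  set σ := α + b / d - κ
  have hσ : 0 < σ := by simp only [σ]; linarith
  set L := (Real.log m - Real.log K) / (d * σ)
  have hR : 0 < Real.exp L := Real.exp_pos _
  have H1 := Hu (Real.exp L) hR
  have H2 := ENNReal.toReal_mono (by finiteness) H1
  rw [ENNReal.toReal_add (by finiteness) (by finiteness), ENNReal.toReal_mul, ENNReal.toReal_mul,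
    ENNReal.toReal_ofReal (by positivity), ENNReal.toReal_ofReal (by positivity), ← hKdef,
    ← Real.exp_mul, ← Real.exp_mul] at H2
  change (recipNorm u s).toReal ≤ C * Real.exp (L * (d * (s - κ))) * K +
    C * Real.exp (L * (d * (s - α) - b)) * m at H2
  have hLσ : L * (d * σ) = Real.log m - Real.log K := by
    simp only [L]; field_simp
  have hbal : Real.exp (L * (d * (s - α) - b)) * m = Real.exp (L * (d * (s - κ))) * K := by
    conv_lhs => rw [← Real.exp_log hMpos]
    conv_rhs => rw [← Real.exp_log hK]
    rw [← Real.exp_add, ← Real.exp_add]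
    congr 1
    have : d * σ = d * (α - κ) + b := by simp only [σ]; field_simp; ring
    rw [this] at hLσ
    linear_combination -hLσ
  have H3 : (recipNorm u s).toReal ≤ 2 * C * (Real.exp (L * (d * (s - κ))) * K) := by
    rw [mul_assoc C _ m, hbal] at H2
    linarith
  have H4 := Real.log_le_log hS H3
  rw [Real.log_mul (by positivity) (by positivity), Real.log_mul (by positivity) hK.ne',
    Real.log_exp] at H4
  have e3 : (s - κ) / σ * (Real.log m - Real.log K) = L * (d * (s - κ)) := by
    simp only [L]; field_simp
  rw [e3]
  linarith

/-- Monotonicity of the slopes of the convex function `s ↦ log ‖u‖_{1/s}` turns interpolation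
between a norm and a moment into a lower bound for the moment by the quotient of any two norms
whose exponents are to the left of `κ` and of the critical value `α + b / d`. -/
theorem exists_le_moment_div [Nontrivial E] {s s' κ α b : ℝ} (hα : 0 ≤ α) (hb : 0 < b)
    (hs' : 0 ≤ s') (hss : s' < s) (hsρ : s < α + b / Module.finrank ℝ E) (hκ : s' ≤ κ)
    (hκρ : κ < α + b / Module.finrank ℝ E) :
    ∃ c₀ : ℝ, 0 < c₀ ∧ ∀ u : 𝓢(E, ℂ), u ≠ 0 → ∀ c : E,
      ENNReal.ofReal (c₀ * ((recipNorm u s).toReal / (recipNorm u s').toReal) ^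
          ((α + b / Module.finrank ℝ E - κ) / (s - s'))) ≤
        recipNorm (fun x => ((‖x - c‖ ^ b : ℝ) : ℂ) * u x) α / recipNorm u κ := by
  have hd : (0 : ℝ) < Module.finrank ℝ E := by exact_mod_cast Module.finrank_pos
  have hκ0 : 0 ≤ κ := hs'.trans hκ
  set ρ := α + b / (Module.finrank ℝ E : ℝ) with hρ
  have hαρ : α < ρ := by
    have : 0 < b / (Module.finrank ℝ E : ℝ) := by positivity
    linarith
  -- The interpolation inequality needs an exponent beyond `s`, `κ` and `α`.
  obtain ⟨s₀, h0, h0ρ⟩ := exists_between (max_lt hsρ (max_lt hκρ hαρ))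
  obtain ⟨hs0, h0⟩ := max_lt_iff.1 h0
  obtain ⟨hκs0, hαs0⟩ := max_lt_iff.1 h0
  obtain ⟨C, H⟩ := exists_log_recipNorm_sub_le (E := E) hκ0 hα hb hκs0 hαs0 h0ρ
  have hσ : 0 < ρ - κ := by linarith
  refine ⟨Real.exp (-(C * (ρ - κ) / (s₀ - κ))), Real.exp_pos _, fun u hu c => ?_⟩
  have hM0 := recipNorm_weight_ne_zero hu b α c
  have Hu := H u hu c
  set M := recipNorm (fun x => ((‖x - c‖ ^ b : ℝ) : ℂ) * u x) α
  have hKt := recipNorm_schwartz_ne_top u κ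
  -- The moment is in fact finite, but its finiteness is not needed.
  rcases eq_or_ne M ∞ with hM | hM
  · rw [hM, ENNReal.top_div_of_ne_top hKt]
    exact le_top
  have hMpos : 0 < M.toReal := ENNReal.toReal_pos hM0 hM
  have hK := toReal_recipNorm_pos hu κ
  have hA := toReal_recipNorm_pos hu s
  have hB := toReal_recipNorm_pos hu s'
  refine ENNReal.ofReal_le_of_le_toReal ?_
  rw [ENNReal.toReal_div]
  have hconv := convexOn_log_recipNorm hu
  set l := fun r => Real.log (recipNorm u r).toReal with hl
  have h1 : (l s - l s') / (s - s') ≤ (l s₀ - l s') / (s₀ - s') :=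
    hconv.secant_mono hs' (hs'.trans hss.le) (by simp only [Set.mem_Ici]; linarith) hss.ne'
      (by linarith : s' < s₀).ne' hs0.le
  have h2 : (l s' - l s₀) / (s' - s₀) ≤ (l κ - l s₀) / (κ - s₀) :=
    hconv.secant_mono (by simp only [Set.mem_Ici]; linarith) hs' hκ0
      (by linarith : s' < s₀).ne hκs0.ne hκ
  have h3 : (l s - l s') / (s - s') ≤ (l s₀ - l κ) / (s₀ - κ) := by
    rw [← neg_div_neg_eq, neg_sub, neg_sub, ← neg_div_neg_eq (l κ - l s₀), neg_sub, neg_sub] at h2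
    exact h1.trans h2
  have h4 : l s₀ - l κ ≤ C + (s₀ - κ) / (ρ - κ) * (Real.log M.toReal - l κ) := Hu hM
  have hsκ : 0 < s₀ - κ := by linarith
  have h5 : (ρ - κ) * ((l s - l s') / (s - s')) - C * (ρ - κ) / (s₀ - κ) ≤
      Real.log M.toReal - l κ := by
    have h6 : (l s - l s') / (s - s') ≤
        (C + (s₀ - κ) / (ρ - κ) * (Real.log M.toReal - l κ)) / (s₀ - κ) :=
      h3.trans (by gcongr)
    have h7 := mul_le_mul_of_nonneg_left h6 hσ.le
    have h8 : (ρ - κ) * ((C + (s₀ - κ) / (ρ - κ) * (Real.log M.toReal - l κ)) / (s₀ - κ)) =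
        C * (ρ - κ) / (s₀ - κ) + (Real.log M.toReal - l κ) := by
      field_simp
    linarith
  have e1 : ((recipNorm u s).toReal / (recipNorm u s').toReal) ^ ((ρ - κ) / (s - s')) =
      Real.exp ((ρ - κ) * ((l s - l s') / (s - s'))) := by
    rw [Real.rpow_def_of_pos (by positivity), Real.log_div hA.ne' hB.ne']
    congr 1
    simp only [hl]
    ring
  rw [e1, ← Real.exp_add, ← Real.exp_log (div_pos hMpos hK), Real.log_div hMpos.ne' hK.ne']
  refine Real.exp_le_exp.2 ?_
  simp only [hl] at h5 ⊢
  linarith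

end MomentInequality

/-! ### The Schrödinger flow on Schwartz functions -/

section Propagator

variable {E : Type*} [NormedAddCommGroup E]

variable (E) in
/-- The multiplier `exp (-i t |2πξ|²)` of the free Schrödinger flow. -/
noncomputable def schrodingerSymbol (t : ℝ) (ξ : E) : ℂ :=
  Complex.exp (-(4 * (Real.pi : ℂ) ^ 2 * Complex.I * (t : ℂ) * ((‖ξ‖ ^ 2 : ℝ) : ℂ)))

theorem norm_schrodingerSymbol (t : ℝ) (ξ : E) : ‖schrodingerSymbol E t ξ‖ = 1 := by
  have : -(4 * (Real.pi : ℂ) ^ 2 * Complex.I * (t : ℂ) * ((‖ξ‖ ^ 2 : ℝ) : ℂ)) =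
      ((-(4 * Real.pi ^ 2 * t * ‖ξ‖ ^ 2) : ℝ) : ℂ) * Complex.I := by
    push_cast; ring
  rw [schrodingerSymbol, this, Complex.norm_exp_ofReal_mul_I]

theorem hasTemperateGrowth_cexp_mul_I :
    (fun s : ℝ => Complex.exp (s * Complex.I)).HasTemperateGrowth := by
  have hder : ∀ n : ℕ, iteratedDeriv n (fun s : ℝ => Complex.exp (s * Complex.I)) =
      fun s : ℝ => Complex.I ^ n * Complex.exp (s * Complex.I) := by
    intro n
    induction n with
    | zero => ext s; simp
    | succ k ih =>
      rw [iteratedDeriv_succ, ih]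
      ext s
      have h1 : HasDerivAt (fun s : ℝ => Complex.exp (s * Complex.I))
          (Complex.exp (s * Complex.I) * (1 * Complex.I)) s :=
        ((Complex.ofRealCLM.hasDerivAt (x := s)).mul_const Complex.I).cexp
      rw [(h1.const_mul (Complex.I ^ k)).deriv]
      ring
  refine ⟨?_, fun n => ⟨0, 1, fun s => ?_⟩⟩
  · exact (Complex.ofRealCLM.contDiff.mul contDiff_const).cexp
  · rw [norm_iteratedFDeriv_eq_norm_iteratedDeriv, hder]
    simp [Complex.norm_exp_ofReal_mul_I]

variable [InnerProductSpace ℝ E]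

theorem hasTemperateGrowth_schrodingerSymbol (t : ℝ) :
    (schrodingerSymbol E t).HasTemperateGrowth := by
  have h1 : (fun ξ : E => -(4 * Real.pi ^ 2 * t) * ‖ξ‖ ^ 2).HasTemperateGrowth :=
    (Function.HasTemperateGrowth.const _).mul (Function.hasTemperateGrowth_norm_sq E)
  have h2 := hasTemperateGrowth_cexp_mul_I.comp h1
  convert h2 using 1
  ext ξ
  simp only [schrodingerSymbol, Function.comp]
  congr 1
  push_cast
  ring

variable [FiniteDimensional ℝ E] [MeasurableSpace E] [BorelSpace E]

variable (E) in
/-- The free Schrödinger flow as an operator on Schwartz functions. -/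
noncomputable def schrodingerPropagator (t : ℝ) : 𝓢(E, ℂ) →L[ℂ] 𝓢(E, ℂ) :=
  SchwartzMap.fourierMultiplierCLM ℂ (schrodingerSymbol E t)

theorem schrodingerPropagator_apply (t : ℝ) (u : 𝓢(E, ℂ)) :
    (schrodingerPropagator E t u : E → ℂ) =
      𝓕⁻ (fun ξ : E => schrodingerSymbol E t ξ * 𝓕 (u : E → ℂ) ξ) := by
  rw [schrodingerPropagator, SchwartzMap.fourierMultiplierCLM_apply, SchwartzMap.fourierInv_coe]
  congr 1
  ext ξ
  rw [SchwartzMap.smulLeftCLM_apply_apply (hasTemperateGrowth_schrodingerSymbol t), smul_eq_mul,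
    SchwartzMap.fourier_coe]

theorem schrodingerPropagator_neg_apply_self (t : ℝ) (u : 𝓢(E, ℂ)) :
    schrodingerPropagator E (-t) (schrodingerPropagator E t u) = u := by
  rw [schrodingerPropagator, schrodingerPropagator,
    SchwartzMap.fourierMultiplierCLM_fourierMultiplierCLM_apply
      (hasTemperateGrowth_schrodingerSymbol _) (hasTemperateGrowth_schrodingerSymbol _)]
  have : schrodingerSymbol E (-t) * schrodingerSymbol E t = fun _ => 1 := by
    ext ξ
    rw [Pi.mul_apply, schrodingerSymbol, schrodingerSymbol, ← Complex.exp_add]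
    simp
  rw [this, SchwartzMap.fourierMultiplierCLM_const]
  simp

theorem schrodingerPropagator_ne_zero (t : ℝ) {u : 𝓢(E, ℂ)} (hu : u ≠ 0) :
    schrodingerPropagator E t u ≠ 0 := by
  intro h
  apply hu
  rw [← schrodingerPropagator_neg_apply_self t u, h, map_zero]

theorem eLpNorm_two_schrodingerPropagator (t : ℝ) (u : 𝓢(E, ℂ)) :
    eLpNorm (schrodingerPropagator E t u) 2 volume = eLpNorm u 2 volume := by
  have key : ∀ v : 𝓢(E, ℂ), eLpNorm ((𝓕 v : 𝓢(E, ℂ)) : E → ℂ) 2 volume = eLpNorm v 2 volume := by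
    intro v
    have h := SchwartzMap.norm_fourier_toL2_eq v
    rw [SchwartzMap.norm_toLp, SchwartzMap.norm_toLp] at h
    exact (ENNReal.toReal_eq_toReal_iff' ((𝓕 v).eLpNorm_lt_top 2 volume).ne
      (v.eLpNorm_lt_top 2 volume).ne).1 h
  rw [← key, ← key u, schrodingerPropagator, SchwartzMap.fourierMultiplierCLM_apply,
    FourierTransform.fourier_fourierInv_eq]
  refine eLpNorm_congr_norm_ae (ae_of_all _ fun ξ => ?_)
  rw [SchwartzMap.smulLeftCLM_apply_apply (hasTemperateGrowth_schrodingerSymbol t), norm_smul,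
    norm_schrodingerSymbol, one_mul]

/-- The Fourier transform of a complex Gaussian gives a bound that is uniform down to the
imaginary axis of the parameter `β`. -/
theorem norm_integral_gaussian_mul_fourier_le {β : ℂ} (hβ : 0 < β.re) (u : 𝓢(E, ℂ)) (x : E) :
    ‖∫ ξ : E, Complex.exp (-β * ‖ξ‖ ^ 2 + 2 * Real.pi * Complex.I * inner ℝ x ξ) *
        𝓕 (u : E → ℂ) ξ‖ ≤
      (Real.pi / ‖β‖) ^ (Module.finrank ℝ E / 2 : ℝ) * ∫ y, ‖u y‖ := by
  set G : E → ℂ := fun ξ => Complex.exp (-β * ‖ξ‖ ^ 2 + 2 * Real.pi * Complex.I * inner ℝ x ξ)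
  have hG : Integrable G volume :=
    GaussianFourier.integrable_cexp_neg_mul_sq_norm_add hβ (2 * Real.pi * Complex.I) x
  have hflip : ∫ ξ, 𝓕 (u : E → ℂ) ξ • G ξ = ∫ y, u y • 𝓕 G y := by
    have := VectorFourier.integral_fourierIntegral_smul_eq_flip (μ := (volume : Measure E))
      (ν := (volume : Measure E)) (L := innerₗ E) (f := (u : E → ℂ)) (g := G)
      Real.continuous_fourierChar continuous_inner u.integrable hG
    simpa using! this
  have hswap : ∫ ξ, G ξ * 𝓕 (u : E → ℂ) ξ = ∫ y, u y * 𝓕 G y := by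
    simp only [smul_eq_mul] at hflip
    rw [← hflip]
    exact integral_congr_ae (ae_of_all _ fun ξ => mul_comm _ _)
  rw [hswap, ← integral_const_mul]
  refine norm_integral_le_of_norm_le (u.integrable.norm.const_mul _) (ae_of_all _ fun y => ?_)
  rw [fourier_gaussian_innerProductSpace' hβ x y, norm_mul, mul_comm, norm_mul]
  have h1 : ‖(Real.pi / β) ^ (Module.finrank ℝ E / 2 : ℂ)‖ =
      (Real.pi / ‖β‖) ^ (Module.finrank ℝ E / 2 : ℝ) := by
    have : (Module.finrank ℝ E / 2 : ℂ) = ((Module.finrank ℝ E / 2 : ℝ) : ℂ) := by push_cast; rfl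
    rw [this, Complex.norm_cpow_real, norm_div, Complex.norm_real, Real.norm_eq_abs,
      abs_of_pos Real.pi_pos]
  have h2 : ‖Complex.exp (-Real.pi ^ 2 * ‖x - y‖ ^ 2 / β)‖ ≤ 1 := by
    rw [Complex.norm_exp, Real.exp_le_one_iff]
    have : (-Real.pi ^ 2 * ‖x - y‖ ^ 2 / β : ℂ) =
        ((-(Real.pi ^ 2 * ‖x - y‖ ^ 2) : ℝ) : ℂ) * β⁻¹ := by
      push_cast; ring
    rw [this, Complex.re_ofReal_mul, Complex.inv_re]
    have := Complex.normSq_nonneg β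
    have h3 : 0 ≤ β.re / Complex.normSq β := by positivity
    have h4 : 0 ≤ Real.pi ^ 2 * ‖x - y‖ ^ 2 := by positivity
    nlinarith
  rw [h1]
  gcongr
  exact mul_le_of_le_one_right (by positivity) h2

/-- The dispersive estimate, with the Fourier inversion integral regularized by `exp (-ε|ξ|²)`. -/
theorem norm_schrodingerPropagator_le {t : ℝ} (ht : t ≠ 0) (u : 𝓢(E, ℂ)) (x : E) :
    ‖schrodingerPropagator E t u x‖ ≤
      (4 * Real.pi * |t|) ^ (-(Module.finrank ℝ E / 2 : ℝ)) * ∫ y, ‖u y‖ := by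
  have htpos : 0 < |t| := abs_pos.2 ht
  set β : ℝ → ℂ := fun ε => ε + 4 * Real.pi ^ 2 * Complex.I * t
  set G : ℝ → E → ℂ := fun ε ξ =>
    Complex.exp (-(β ε) * ‖ξ‖ ^ 2 + 2 * Real.pi * Complex.I * inner ℝ x ξ) * 𝓕 (u : E → ℂ) ξ
  have hre : ∀ ε : ℝ, (β ε).re = ε := by
    intro ε
    have : β ε = (ε : ℂ) + ((4 * Real.pi ^ 2 * t : ℝ) : ℂ) * Complex.I := by
      simp only [β]; push_cast; ring
    rw [this, Complex.add_re, Complex.re_ofReal_mul]; simp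
  have him : ∀ ε : ℝ, (β ε).im = 4 * Real.pi ^ 2 * t := by
    intro ε
    have : β ε = (ε : ℂ) + ((4 * Real.pi ^ 2 * t : ℝ) : ℂ) * Complex.I := by
      simp only [β]; push_cast; ring
    rw [this, Complex.add_im, Complex.im_ofReal_mul]; simp
  have hFint : Integrable (𝓕 (u : E → ℂ)) volume := by
    rw [← SchwartzMap.fourier_coe]; exact (𝓕 u).integrable
  have h0 : schrodingerPropagator E t u x = ∫ ξ, G 0 ξ := by
    rw [schrodingerPropagator_apply, Real.fourierInv_eq']
    refine integral_congr_ae (ae_of_all _ fun ξ => ?_)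
    simp only [G, β, schrodingerSymbol, smul_eq_mul]
    rw [← mul_assoc, ← Complex.exp_add, real_inner_comm]
    congr 2
    push_cast
    ring
  have hlim : Filter.Tendsto (fun ε : ℝ => ∫ ξ, G ε ξ) (nhdsWithin 0 (Set.Ioi 0))
      (nhds (∫ ξ, G 0 ξ)) := by
    refine tendsto_integral_filter_of_dominated_convergence (fun ξ => ‖𝓕 (u : E → ℂ) ξ‖)
      (Filter.Eventually.of_forall fun ε => ?_) ?_ hFint.norm (ae_of_all _ fun ξ => ?_)
    · refine AEStronglyMeasurable.mul (Continuous.aestronglyMeasurable ?_)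
        hFint.aestronglyMeasurable
      fun_prop
    · filter_upwards [self_mem_nhdsWithin] with ε hε
      refine ae_of_all _ fun ξ => ?_
      rw [norm_mul]
      refine mul_le_of_le_one_left (norm_nonneg _) ?_
      rw [Complex.norm_exp, Real.exp_le_one_iff]
      have e1 : (-(β ε) * ‖ξ‖ ^ 2 + 2 * Real.pi * Complex.I * inner ℝ x ξ : ℂ) =
          -(((‖ξ‖ ^ 2 : ℝ) : ℂ) * β ε) + ((2 * Real.pi * inner ℝ x ξ : ℝ) : ℂ) * Complex.I := by
        push_cast; ring
      rw [e1, Complex.add_re, Complex.neg_re, Complex.re_ofReal_mul, hre,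
        Complex.re_ofReal_mul, Complex.I_re]
      have : 0 ≤ ‖ξ‖ ^ 2 * ε := mul_nonneg (by positivity) (le_of_lt hε)
      linarith
    · have : Continuous fun ε : ℝ => G ε ξ := by
        simp only [G, β]
        fun_prop
      exact (this.tendsto 0).mono_left nhdsWithin_le_nhds
  rw [h0]
  refine le_of_tendsto hlim.norm ?_
  filter_upwards [self_mem_nhdsWithin] with ε hε
  refine (norm_integral_gaussian_mul_fourier_le (by rw [hre]; exact hε) u x).trans ?_
  gcongr
  have hβ : 4 * Real.pi ^ 2 * |t| ≤ ‖β ε‖ := by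
    have := Complex.abs_im_le_norm (β ε)
    rwa [him, abs_mul, abs_of_pos (by positivity : 0 < 4 * Real.pi ^ 2)] at this
  rw [Real.rpow_neg (by positivity), ← Real.inv_rpow (by positivity)]
  refine Real.rpow_le_rpow (by positivity) ?_ (by positivity)
  calc Real.pi / ‖β ε‖ ≤ Real.pi / (4 * Real.pi ^ 2 * |t|) := by gcongr
    _ = (4 * Real.pi * |t|)⁻¹ := by field_simp

end Propagator

/-! ### Real interpolation between `L¹ → L^∞` and `L² → L²` -/

section RealInterpolation

/-- Integrability of the profile that smooth truncation produces: `e - 2 > -1` at the origin and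
`e - 2 - 4e < -1` at infinity. -/
theorem integrableOn_rpow_mul_inv_one_add_sq {e : ℝ} (he : 1 < e) :
    IntegrableOn (fun t : ℝ => t ^ (e - 2) * ((1 + (t ^ e) ^ 2)⁻¹) ^ 2) (Set.Ioi 0) := by
  have hm : Measurable fun t : ℝ => t ^ (e - 2) * ((1 + (t ^ e) ^ 2)⁻¹) ^ 2 := by fun_prop
  rw [← Set.Ioc_union_Ioi_eq_Ioi (zero_le_one (α := ℝ))]
  refine IntegrableOn.union ?_ ?_
  · have h1 : IntegrableOn (fun t : ℝ => t ^ (e - 2)) (Set.Ioc 0 1) := by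
      rw [← intervalIntegrable_iff_integrableOn_Ioc_of_le zero_le_one]
      exact intervalIntegral.intervalIntegrable_rpow' (by linarith)
    refine h1.mono' hm.aestronglyMeasurable ?_
    filter_upwards [self_mem_ae_restrict measurableSet_Ioc] with t ht
    have ht0 : 0 < t := ht.1
    rw [Real.norm_of_nonneg (by positivity)]
    refine mul_le_of_le_one_right (by positivity) (pow_le_one₀ (by positivity) ?_)
    exact inv_le_one_of_one_le₀ (by nlinarith [sq_nonneg (t ^ e)])
  · have h1 : IntegrableOn (fun t : ℝ => t ^ (e - 2 - 4 * e)) (Set.Ioi 1) :=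
      integrableOn_Ioi_rpow_of_lt (by linarith) one_pos
    refine h1.mono' hm.aestronglyMeasurable ?_
    filter_upwards [self_mem_ae_restrict measurableSet_Ioi] with t ht
    have ht0 : 0 < t := one_pos.trans ht
    rw [Real.norm_of_nonneg (by positivity), Real.rpow_sub ht0 (e - 2), div_eq_mul_inv]
    gcongr
    have : t ^ (4 * e) = ((t ^ e) ^ 2) ^ 2 := by
      rw [← pow_mul, ← Real.rpow_natCast, ← Real.rpow_mul ht0.le]
      congr 1; push_cast; ring
    rw [this, ← inv_pow]
    have : 0 < t ^ e := by positivity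
    gcongr
    linarith

theorem integral_rpow_profile_nonneg (e : ℝ) :
    0 ≤ ∫ t in Set.Ioi (0 : ℝ), t ^ (e - 2) * ((1 + (t ^ e) ^ 2)⁻¹) ^ 2 := by
  refine setIntegral_nonneg measurableSet_Ioi fun t ht => ?_
  have : (0 : ℝ) < t := ht
  positivity

/-- The integral over the heights `t` of the squared truncation of `v`, evaluated by homogeneity.
For `v = 0` both sides vanish. -/
theorem lintegral_rpow_profile {e : ℝ} (he : 1 < e) {D v : ℝ} (hD : 0 < D) (hv : 0 ≤ v) :
    ∫⁻ t in Set.Ioi (0 : ℝ),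
        ENNReal.ofReal (4 * t ^ (e - 2) * ((1 + ((t / D) ^ e * v) ^ 2)⁻¹ * v) ^ 2) =
      ENNReal.ofReal (4 * (∫ t in Set.Ioi (0 : ℝ), t ^ (e - 2) * ((1 + (t ^ e) ^ 2)⁻¹) ^ 2) *
        D ^ (e - 1) * v ^ (1 + 1 / e)) := by
  have he0 : 0 < e := by linarith
  rcases hv.eq_or_lt with rfl | hv
  · rw [Real.zero_rpow (by positivity)]
    simp
  set h : ℝ → ℝ := fun t => t ^ (e - 2) * ((1 + (t ^ e) ^ 2)⁻¹) ^ 2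
  -- The substitution `t ↦ k t` turns `(t / D) ^ e * v` into `t ^ e`.
  set k : ℝ := v ^ (1 / e) / D
  have hk : 0 < k := by positivity
  have hint : IntegrableOn h (Set.Ioi 0) := integrableOn_rpow_mul_inv_one_add_sq he
  have hint' : IntegrableOn (fun t => h (k * t)) (Set.Ioi 0) := by
    rw [integrableOn_Ioi_comp_mul_left_iff _ _ hk]
    simpa using hint
  have hval : ∫ t in Set.Ioi (0 : ℝ), h (k * t) = k⁻¹ * ∫ t in Set.Ioi (0 : ℝ), h t := by
    rw [integral_comp_mul_left_Ioi _ _ hk]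
    simp
  have hpt : ∀ t ∈ Set.Ioi (0 : ℝ),
      ENNReal.ofReal (4 * t ^ (e - 2) * ((1 + ((t / D) ^ e * v) ^ 2)⁻¹ * v) ^ 2) =
        ENNReal.ofReal (4 * v ^ 2 * k ^ (2 - e) * h (k * t)) := by
    intro t ht
    have ht0 : (0 : ℝ) < t := ht
    have e1 : (t / D) ^ e * v = (k * t) ^ e := by
      have : k * t = v ^ (1 / e) * (t / D) := by simp only [k]; ring
      rw [this, Real.mul_rpow (by positivity) (by positivity), ← Real.rpow_mul hv.le,
        one_div_mul_cancel he0.ne', Real.rpow_one, mul_comm]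
    have e2 : t ^ (e - 2) = k ^ (2 - e) * (k * t) ^ (e - 2) := by
      rw [Real.mul_rpow hk.le ht0.le, ← mul_assoc, ← Real.rpow_add hk]
      simp
    congr 1
    simp only [h]
    rw [e1, e2]
    ring
  have hnn : ∀ t ∈ Set.Ioi (0 : ℝ), 0 ≤ 4 * v ^ 2 * k ^ (2 - e) * h (k * t) := by
    intro t ht
    have ht0 : (0 : ℝ) < t := ht
    simp only [h]
    positivity
  rw [setLIntegral_congr_fun measurableSet_Ioi hpt,
    ← ofReal_integral_eq_lintegral_ofReal (hint'.const_mul _)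
      ((ae_restrict_iff' measurableSet_Ioi).2 (ae_of_all _ hnn)), integral_const_mul, hval]
  congr 1
  have e3 : k ^ (2 - e) * k⁻¹ = v ^ ((1 - e) / e) * D ^ (e - 1) := by
    rw [← Real.rpow_neg_one k, ← Real.rpow_add hk, Real.div_rpow (by positivity) hD.le,
      ← Real.rpow_mul hv.le, div_eq_mul_inv _ (D ^ _), ← Real.rpow_neg hD.le]
    congr 2 <;> ring
  have e4 : v ^ 2 * v ^ ((1 - e) / e) = v ^ (1 + 1 / e) := by
    rw [← Real.rpow_natCast, ← Real.rpow_add hv]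
    congr 1
    field_simp
    push_cast
    ring
  rw [← e4]
  linear_combination 4 * v ^ 2 * (∫ t in Set.Ioi (0 : ℝ), h t) * e3

variable {E : Type*} [NormedAddCommGroup E] [InnerProductSpace ℝ E]

/-- A smooth truncation `u / (1 + |cu|²)` of `u` at height about `1 / c`. Unlike a sharp cut-off it
stays in the Schwartz space. -/
noncomputable def schwartzTruncation (u : 𝓢(E, ℂ)) (c : ℝ) : 𝓢(E, ℂ) :=
  SchwartzMap.smulLeftCLM ℂ (fun x => (1 + ‖c • u x‖ ^ 2) ^ (-1 : ℝ)) u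

theorem schwartzTruncation_apply (u : 𝓢(E, ℂ)) {c : ℝ} (hc : 0 ≤ c) (x : E) :
    schwartzTruncation u c x = (1 + (c * ‖u x‖) ^ 2)⁻¹ • u x := by
  have h : (fun x => (1 + ‖c • u x‖ ^ 2) ^ (-1 : ℝ)).HasTemperateGrowth :=
    (Function.hasTemperateGrowth_one_add_norm_sq_rpow ℂ (-1)).comp
      ((Function.HasTemperateGrowth.const c).smul u.hasTemperateGrowth)
  rw [schwartzTruncation, SchwartzMap.smulLeftCLM_apply_apply h, norm_smul,
    Real.norm_of_nonneg hc, Real.rpow_neg_one]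

/-- The discarded part of `u`; it is small where `|u|` is below the truncation height. -/
theorem norm_sub_schwartzTruncation_le (u : 𝓢(E, ℂ)) {c r : ℝ} (hc : 0 ≤ c) (hr : 0 < r)
    (hr2 : r ≤ 2) (x : E) :
    ‖(u - schwartzTruncation u c) x‖ ≤ c ^ r * ‖u x‖ ^ (1 + r) := by
  set y := c * ‖u x‖
  have hy : 0 ≤ y := by positivity
  have e1 : (u - schwartzTruncation u c) x = (y ^ 2 * (1 + y ^ 2)⁻¹) • u x := by
    rw [sub_apply, schwartzTruncation_apply u hc]
    nth_rewrite 1 [← one_smul ℝ (u x)]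
    rw [← sub_smul]
    congr 1
    have : (1 + y ^ 2) ≠ 0 := by positivity
    field_simp
    ring
  have e2 : y ^ 2 * (1 + y ^ 2)⁻¹ ≤ y ^ r := by
    rcases le_total y 1 with h | h
    · calc y ^ 2 * (1 + y ^ 2)⁻¹ ≤ y ^ 2 := by
            refine mul_le_of_le_one_right (by positivity) (inv_le_one_of_one_le₀ ?_)
            nlinarith
        _ = y ^ (2 : ℝ) := by norm_cast
        _ ≤ y ^ r := Real.rpow_le_rpow_of_exponent_ge_of_imp hy h hr2 fun _ h0 => absurd h0 two_ne_zero
    · calc y ^ 2 * (1 + y ^ 2)⁻¹ ≤ 1 := by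
            rw [← div_eq_mul_inv, div_le_one (by positivity)]; linarith
        _ ≤ y ^ r := Real.one_le_rpow h hr.le
  rw [e1, norm_smul, Real.norm_of_nonneg (by positivity)]
  calc y ^ 2 * (1 + y ^ 2)⁻¹ * ‖u x‖ ≤ y ^ r * ‖u x‖ := by gcongr
    _ = c ^ r * ‖u x‖ ^ (1 + r) := by
      rw [Real.mul_rpow hc (norm_nonneg _), Real.rpow_add' (norm_nonneg _) (by positivity),
        Real.rpow_one]
      ring

variable [FiniteDimensional ℝ E] [MeasurableSpace E] [BorelSpace E]

/-- The distribution function of `T u` at height `t`: the part of `u` above the truncation height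
contributes at most `t / 2` to `T u` by the `L¹ → L^∞` bound, and the truncated part is controlled
by Chebyshev's inequality in `L²`. -/
theorem measure_lt_norm_le {T : 𝓢(E, ℂ) →ₗ[ℂ] 𝓢(E, ℂ)} {A : ℝ} (hA : 0 < A)
    (h1 : ∀ u x, ‖T u x‖ ≤ A * ∫ y, ‖u y‖)
    (h2 : ∀ u, eLpNorm (T u) 2 volume ≤ eLpNorm u 2 volume) {e : ℝ} (he : 1 < e)
    (u : 𝓢(E, ℂ)) {P : ℝ} (hP : 0 < P)
    (hu : ∫⁻ x, ENNReal.ofReal (‖u x‖ ^ (1 + 1 / e)) = ENNReal.ofReal P) {t : ℝ} (ht : 0 < t) :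
    volume {x | t < ‖T u x‖} * ENNReal.ofReal (t ^ e) ≤
      ∫⁻ x, ENNReal.ofReal
        (4 * t ^ (e - 2) * ((1 + ((t / (2 * A * P)) ^ e * ‖u x‖) ^ 2)⁻¹ * ‖u x‖) ^ 2) := by
  have he0 : 0 < e := by linarith
  -- This height makes the `L^∞` bound of the discarded part exactly `t / 2`.
  set c : ℝ := (t / (2 * A * P)) ^ e
  have hc : 0 ≤ c := by positivity
  set v := schwartzTruncation u c
  have hcr : c ^ (1 / e) = t / (2 * A * P) := by
    rw [← Real.rpow_mul (by positivity), mul_one_div_cancel he0.ne', Real.rpow_one]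
  have hsmall : ∫ y, ‖(u - v) y‖ ≤ c ^ (1 / e) * P := by
    rw [integral_norm_eq_lintegral_enorm (u - v).continuous.aestronglyMeasurable]
    refine ENNReal.toReal_le_of_le_ofReal (by positivity) ?_
    rw [ENNReal.ofReal_mul (by positivity), ← hu, ← lintegral_const_mul' _ _ ENNReal.ofReal_ne_top]
    refine lintegral_mono fun x => ?_
    rw [← ENNReal.ofReal_mul (by positivity), ← ofReal_norm]
    exact ENNReal.ofReal_le_ofReal (norm_sub_schwartzTruncation_le u hc (by positivity)
      (by rw [div_le_iff₀ he0]; linarith) x)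
  have hsub : {x | t < ‖T u x‖} ⊆ {x | ENNReal.ofReal (t / 2) ≤ ‖T v x‖ₑ} := by
    intro x hx
    have hx : t < ‖T u x‖ := hx
    have e1 : T u x = T (u - v) x + T v x := by
      rw [← add_apply, ← map_add, sub_add_cancel]
    have e2 : ‖T (u - v) x‖ ≤ t / 2 := by
      refine (h1 _ _).trans ((mul_le_mul_of_nonneg_left hsmall hA.le).trans (le_of_eq ?_))
      rw [hcr]
      field_simp
    have e3 := norm_add_le (T (u - v) x) (T v x)
    rw [← e1] at e3
    rw [Set.mem_ofPred_eq, ← ofReal_norm]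
    exact ENNReal.ofReal_le_ofReal (by linarith)
  have hcheb : volume {x | t < ‖T u x‖} ≤
      (ENNReal.ofReal (t / 2))⁻¹ ^ 2 * ∫⁻ x, ‖v x‖ₑ ^ 2 := by
    refine (measure_mono hsub).trans ?_
    have h3 := meas_ge_le_mul_pow_eLpNorm_enorm (volume : Measure E) (p := 2) (by simp) (by simp)
      (T v).continuous.aestronglyMeasurable (ε := ENNReal.ofReal (t / 2)) (by simpa using ht)
      (by simp)
    simp only [ENNReal.toReal_ofNat, ENNReal.rpow_ofNat] at h3
    have h4 : eLpNorm v 2 volume ^ 2 = ∫⁻ x, ‖v x‖ₑ ^ 2 := by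
      have := eLpNorm_nnreal_pow_eq_lintegral (μ := (volume : Measure E)) (f := v) (p := 2)
        (by norm_num)
      simpa using this
    rw [← h4]
    exact h3.trans (by gcongr; exact h2 v)
  refine (mul_le_mul_left hcheb _).trans (le_of_eq ?_)
  rw [mul_comm, ← mul_assoc, ← lintegral_const_mul' _ _ (by finiteness)]
  refine lintegral_congr fun x => ?_
  rw [← ofReal_norm, ← ENNReal.ofReal_inv_of_pos (by positivity),
    ← ENNReal.ofReal_pow (by positivity), ← ENNReal.ofReal_pow (by positivity),
    ← ENNReal.ofReal_mul (by positivity), ← ENNReal.ofReal_mul (by positivity)]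
  congr 1
  rw [schwartzTruncation_apply u hc, norm_smul, Real.norm_of_nonneg (by positivity),
    Real.rpow_sub ht, Real.rpow_two]
  field_simp
  ring

/-- Marcinkiewicz interpolation between `L¹ → L^∞` and `L² → L²`, with the natural dependence on
the `L¹ → L^∞` bound `A`. Here `1 + 1/e` and `1 + e` are conjugate exponents. -/
theorem exists_recipNorm_map_le {e : ℝ} (he : 1 < e) :
    ∃ C : ℝ, 0 < C ∧ ∀ (T : 𝓢(E, ℂ) →ₗ[ℂ] 𝓢(E, ℂ)) (A : ℝ), 0 < A →
      (∀ u x, ‖T u x‖ ≤ A * ∫ y, ‖u y‖) →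
      (∀ u, eLpNorm (T u) 2 volume ≤ eLpNorm u 2 volume) →
      ∀ u, recipNorm (T u) (1 / (1 + e)) ≤
        ENNReal.ofReal (C * A ^ ((e - 1) / (1 + e))) * recipNorm u (e / (1 + e)) := by
  have he0 : 0 < e := by linarith
  set J := ∫ t in Set.Ioi (0 : ℝ), t ^ (e - 2) * ((1 + (t ^ e) ^ 2)⁻¹) ^ 2
  have hJ : 0 ≤ J := integral_rpow_profile_nonneg e
  refine ⟨((1 + e) * (4 * (J + 1) * 2 ^ (e - 1))) ^ (1 / (1 + e)), by positivity, ?_⟩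
  intro T A hA h1 h2 u
  rcases eq_or_ne u 0 with rfl | hu
  · rw [map_zero, recipNorm]
    exact (eLpNorm_zero (ε := ℂ)).trans_le bot_le
  set N := (recipNorm u (e / (1 + e))).toReal
  have hN : 0 < N := toReal_recipNorm_pos hu _
  have hNe : recipNorm u (e / (1 + e)) = ENNReal.ofReal N :=
    (ENNReal.ofReal_toReal (recipNorm_schwartz_ne_top u _)).symm
  have key : ∀ (w : 𝓢(E, ℂ)) {p : ℝ}, 0 < p →
      ∫⁻ x, ENNReal.ofReal (‖w x‖ ^ p) = recipNorm w (1 / p) ^ p := by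
    intro w p hp
    have e1 : (ENNReal.ofReal (1 / p))⁻¹ = ENNReal.ofReal p := by
      rw [← ENNReal.ofReal_inv_of_pos (by positivity), one_div, inv_inv]
    rw [recipNorm, e1, eLpNorm_eq_lintegral_rpow_enorm_toReal (by simpa using hp)
      ENNReal.ofReal_ne_top, ENNReal.toReal_ofReal hp.le, ← ENNReal.rpow_mul,
      one_div_mul_cancel hp.ne', ENNReal.rpow_one]
    refine lintegral_congr fun x => ?_
    rw [← ofReal_norm, ENNReal.ofReal_rpow_of_nonneg (norm_nonneg _) hp.le]
  set P := N ^ (1 + 1 / e)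
  have hP : 0 < P := by positivity
  have hPu : ∫⁻ x, ENNReal.ofReal (‖u x‖ ^ (1 + 1 / e)) = ENNReal.ofReal P := by
    have : 1 / (1 + 1 / e) = e / (1 + e) := by field_simp; ring
    rw [key u (by positivity), this, hNe, ENNReal.ofReal_rpow_of_nonneg hN.le (by positivity)]
  set D := 2 * A * P
  have hD : 0 < D := by positivity
  have hmain : ∫⁻ x, ENNReal.ofReal (‖T u x‖ ^ (1 + e)) ≤
      ENNReal.ofReal ((1 + e) * (4 * (J + 1) * D ^ (e - 1)) * P) := by
    rw [lintegral_rpow_eq_lintegral_meas_lt_mul _ (ae_of_all _ fun x => norm_nonneg _)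
      (T u).continuous.norm.aemeasurable (by positivity), mul_assoc (1 + e),
      ENNReal.ofReal_mul (by positivity)]
    refine mul_le_mul_right ?_ _
    rw [add_sub_cancel_left]
    calc ∫⁻ t in Set.Ioi (0 : ℝ), volume {x | t < ‖T u x‖} * ENNReal.ofReal (t ^ e)
        ≤ ∫⁻ t in Set.Ioi (0 : ℝ), ∫⁻ x, ENNReal.ofReal
          (4 * t ^ (e - 2) * ((1 + ((t / D) ^ e * ‖u x‖) ^ 2)⁻¹ * ‖u x‖) ^ 2) :=
          setLIntegral_mono' measurableSet_Ioi fun t ht =>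
            measure_lt_norm_le hA h1 h2 he u hP hPu ht
      _ = ∫⁻ x, ∫⁻ t in Set.Ioi (0 : ℝ), ENNReal.ofReal
          (4 * t ^ (e - 2) * ((1 + ((t / D) ^ e * ‖u x‖) ^ 2)⁻¹ * ‖u x‖) ^ 2) := by
          refine lintegral_lintegral_swap (Measurable.aemeasurable ?_)
          have hum : Measurable u := u.continuous.measurable
          simp only [Function.uncurry_def]
          fun_prop
      _ = ∫⁻ x, ENNReal.ofReal (4 * J * D ^ (e - 1)) *
            ENNReal.ofReal (‖u x‖ ^ (1 + 1 / e)) := by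
          refine lintegral_congr fun x => ?_
          rw [lintegral_rpow_profile he hD (norm_nonneg _), ENNReal.ofReal_mul (by positivity)]
      _ = ENNReal.ofReal (4 * J * D ^ (e - 1) * P) := by
          rw [lintegral_const_mul' _ _ ENNReal.ofReal_ne_top, hPu,
            ENNReal.ofReal_mul (p := 4 * J * D ^ (e - 1)) (by positivity)]
      _ ≤ ENNReal.ofReal (4 * (J + 1) * D ^ (e - 1) * P) := by
          refine ENNReal.ofReal_le_ofReal ?_
          gcongr
          linarith
  rw [key (T u) (by positivity)] at hmain
  have hroot := ENNReal.rpow_le_rpow hmain (by positivity : 0 ≤ 1 / (1 + e))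
  rw [← ENNReal.rpow_mul, mul_one_div_cancel (by positivity), ENNReal.rpow_one,
    ENNReal.ofReal_rpow_of_nonneg (by positivity) (by positivity)] at hroot
  refine hroot.trans (le_of_eq ?_)
  rw [hNe, ← ENNReal.ofReal_mul (by positivity)]
  congr 1
  have e1 : (1 + e) * (4 * (J + 1) * D ^ (e - 1)) * P =
      (1 + e) * (4 * (J + 1) * 2 ^ (e - 1)) * (A ^ (e - 1) * N ^ (1 + e)) := by
    have e2 : P ^ (e - 1) * P = N ^ (1 + e) := by
      nth_rewrite 2 [← Real.rpow_one P]
      rw [← Real.rpow_add hP, ← Real.rpow_mul hN.le]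
      congr 1
      field_simp
      ring
    rw [← e2]
    simp only [D]
    rw [Real.mul_rpow (by positivity) hP.le, Real.mul_rpow (by positivity) hA.le]
    ring
  rw [e1, Real.mul_rpow (by positivity) (by positivity),
    Real.mul_rpow (x := A ^ (e - 1)) (by positivity) (by positivity), ← Real.rpow_mul hA.le, ← Real.rpow_mul hN.le, mul_one_div_cancel
    (by positivity), Real.rpow_one, mul_one_div]
  ring

/-- Hausdorff–Young type bounds, up to a constant, for the whole range `1/2 ≤ s ≤ 1` of
reciprocal exponents. -/
theorem exists_recipNorm_map_one_sub_le {s : ℝ} (hs : 1 / 2 ≤ s) (hs1 : s ≤ 1) :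
    ∃ C : ℝ, 0 < C ∧ ∀ (T : 𝓢(E, ℂ) →ₗ[ℂ] 𝓢(E, ℂ)) (A : ℝ), 0 < A →
      (∀ u x, ‖T u x‖ ≤ A * ∫ y, ‖u y‖) →
      (∀ u, eLpNorm (T u) 2 volume ≤ eLpNorm u 2 volume) →
      ∀ u, recipNorm (T u) (1 - s) ≤ ENNReal.ofReal (C * A ^ (2 * s - 1)) * recipNorm u s := by
  rcases hs.eq_or_lt with rfl | hs
  · refine ⟨1, one_pos, fun T A hA h1 h2 u => ?_⟩
    have e1 : (ENNReal.ofReal (1 / 2))⁻¹ = 2 := by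
      rw [← ENNReal.ofReal_inv_of_pos (by norm_num)]; norm_num
    have e2 : (1 : ℝ) - 1 / 2 = 1 / 2 := by norm_num
    rw [e2, recipNorm, recipNorm, e1]
    simpa using h2 u
  rcases hs1.eq_or_lt with rfl | hs1
  · refine ⟨1, one_pos, fun T A hA h1 h2 u => ?_⟩
    have e2 : (2 : ℝ) * 1 - 1 = 1 := by norm_num
    rw [e2, Real.rpow_one, one_mul, sub_self, recipNorm, recipNorm]
    simp only [ENNReal.ofReal_zero, ENNReal.inv_zero, ENNReal.ofReal_one, inv_one]
    rw [eLpNorm_one_eq_lintegral_enorm, eLpNorm_exponent_top]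
    refine eLpNormEssSup_le_of_ae_enorm_bound (ae_of_all _ fun x => ?_)
    rw [← ofReal_integral_norm_eq_lintegral_enorm u.integrable, ← ENNReal.ofReal_mul hA.le,
      ← ofReal_norm]
    exact ENNReal.ofReal_le_ofReal (h1 u x)
  have h1s : 0 < 1 - s := by linarith
  have he : 1 < s / (1 - s) := by rw [lt_div_iff₀ h1s]; linarith
  obtain ⟨C, hC, H⟩ := exists_recipNorm_map_le (E := E) he
  refine ⟨C, hC, fun T A hA h1 h2 u => ?_⟩
  have e0 : 1 + s / (1 - s) = (1 - s)⁻¹ := by field_simp; ring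
  have e1 : 1 / (1 + s / (1 - s)) = 1 - s := by rw [e0, one_div, inv_inv]
  have e2 : s / (1 - s) / (1 + s / (1 - s)) = s := by rw [e0]; field_simp
  have e3 : (s / (1 - s) - 1) / (1 + s / (1 - s)) = 2 * s - 1 := by rw [e0]; field_simp; ring
  have := H T A hA h1 h2 u
  rwa [e1, e2, e3] at this

end RealInterpolation

/-! ### Moments of a solution at two times -/

section UncertaintyPrinciple

variable {E : Type*} [NormedAddCommGroup E] [InnerProductSpace ℝ E] [FiniteDimensional ℝ E]
  [MeasurableSpace E] [BorelSpace E]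

/-- Decay of the flow, written as a lower bound for the initial datum. -/
theorem exists_mul_recipNorm_schrodingerPropagator_le {s : ℝ} (hs : 1 / 2 ≤ s) (hs1 : s ≤ 1) :
    ∃ c : ℝ, 0 < c ∧ ∀ t : ℝ, t ≠ 0 → ∀ u : 𝓢(E, ℂ),
      c * |t| ^ (Module.finrank ℝ E * (s - 1 / 2)) *
        (recipNorm (schrodingerPropagator E t u) (1 - s)).toReal ≤ (recipNorm u s).toReal := by
  obtain ⟨C, hC, H⟩ := exists_recipNorm_map_one_sub_le (E := E) hs hs1
  set d : ℝ := (Module.finrank ℝ E : ℝ)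
  set B : ℝ := (4 * Real.pi) ^ (-(d * (s - 1 / 2)))
  refine ⟨(C * B)⁻¹, by positivity, fun t ht u => ?_⟩
  have htpos : 0 < |t| := abs_pos.2 ht
  have h1 := H (schrodingerPropagator E t : 𝓢(E, ℂ) →ₗ[ℂ] 𝓢(E, ℂ))
    ((4 * Real.pi * |t|) ^ (-(d / 2))) (by positivity)
    (fun u x => norm_schrodingerPropagator_le ht u x)
    (fun u => (eLpNorm_two_schrodingerPropagator t u).le) u
  have h2 := ENNReal.toReal_mono (ENNReal.mul_ne_top ENNReal.ofReal_ne_top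
    (recipNorm_schwartz_ne_top u s)) h1
  rw [ENNReal.toReal_mul, ENNReal.toReal_ofReal (by positivity), ← Real.rpow_mul (by positivity),
    show -(d / 2) * (2 * s - 1) = -(d * (s - 1 / 2)) by ring,
    Real.mul_rpow (by positivity) htpos.le, Real.rpow_neg htpos.le] at h2
  have h3 : 0 < |t| ^ (d * (s - 1 / 2)) := by positivity
  calc (C * B)⁻¹ * |t| ^ (d * (s - 1 / 2)) *
        (recipNorm (schrodingerPropagator E t u) (1 - s)).toReal
      ≤ (C * B)⁻¹ * |t| ^ (d * (s - 1 / 2)) *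
        (C * (B * (|t| ^ (d * (s - 1 / 2)))⁻¹) * (recipNorm u s).toReal) := by
        gcongr
        exact h2
    _ = (recipNorm u s).toReal := by
        have : B ≠ 0 := by positivity
        field_simp

/-- The same bound for the time-reversed flow. -/
theorem exists_mul_recipNorm_le_schrodingerPropagator {s : ℝ} (hs : 1 / 2 ≤ s) (hs1 : s ≤ 1) :
    ∃ c : ℝ, 0 < c ∧ ∀ t : ℝ, t ≠ 0 → ∀ u : 𝓢(E, ℂ),
      c * |t| ^ (Module.finrank ℝ E * (s - 1 / 2)) * (recipNorm u (1 - s)).toReal ≤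
        (recipNorm (schrodingerPropagator E t u) s).toReal := by
  obtain ⟨c, hc, H⟩ := exists_mul_recipNorm_schrodingerPropagator_le (E := E) hs hs1
  refine ⟨c, hc, fun t ht u => ?_⟩
  have := H (-t) (neg_ne_zero.2 ht) (schrodingerPropagator E t u)
  rwa [abs_neg, schrodingerPropagator_neg_apply_self] at this

/-- The case `s = 1` is only needed when `κ = 0`, but it is available whenever `1 < ρ`. -/
theorem exists_recip_exponent {κ ρ : ℝ} (hκ : 0 ≤ κ) (hρ : 1 / 2 < ρ) (h : 1 < κ + ρ) :
    ∃ s, 1 / 2 < s ∧ s ≤ 1 ∧ s < ρ ∧ 1 - s ≤ κ := by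
  rcases lt_or_ge 1 ρ with h1 | h1
  · exact ⟨1, by norm_num, le_rfl, h1, by simpa using hκ⟩
  · obtain ⟨s, hs, hsρ⟩ := exists_between (max_lt hρ (by linarith : 1 - κ < ρ))
    obtain ⟨hs2, hsκ⟩ := max_lt_iff.1 hs
    exact ⟨s, hs2, by linarith, hsρ, by linarith⟩

/-- The uncertainty principle in terms of reciprocal exponents. -/
theorem exists_le_moment_div_rpow_mul [Nontrivial E] {α₁ α₂ κ₁ κ₂ b₁ b₂ ρ₁ ρ₂ : ℝ}
    (hα₁ : 0 ≤ α₁) (hα₂ : 0 ≤ α₂) (hκ₁ : 0 ≤ κ₁) (hκ₂ : 0 ≤ κ₂) (hb₁ : 0 < b₁) (hb₂ : 0 < b₂)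
    (hρ₁ : ρ₁ = α₁ + b₁ / Module.finrank ℝ E) (hρ₂ : ρ₂ = α₂ + b₂ / Module.finrank ℝ E)
    (h₁ : 1 / 2 < ρ₁) (h₂ : 1 / 2 < ρ₂) (hκρ₁ : κ₁ < ρ₁) (hκρ₂ : κ₂ < ρ₂)
    (h₁₂ : 1 < κ₁ + ρ₂) (h₂₁ : 1 < κ₂ + ρ₁) :
    ∃ C : ℝ, 0 < C ∧ ∀ u : 𝓢(E, ℂ), u ≠ 0 → ∀ t : ℝ, t ≠ 0 → ∀ x₀ x₁ : E,
      ENNReal.ofReal (C * |t| ^ (Module.finrank ℝ E * (ρ₁ - κ₁) * (ρ₂ - κ₂))) ≤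
        (recipNorm (fun x => ((‖x - x₀‖ ^ b₁ : ℝ) : ℂ) * u x) α₁ / recipNorm u κ₁) ^ (ρ₂ - κ₂) *
        (recipNorm (fun x => ((‖x - x₁‖ ^ b₂ : ℝ) : ℂ) * schrodingerPropagator E t u x) α₂ /
          recipNorm (schrodingerPropagator E t u) κ₂) ^ (ρ₁ - κ₁) := by
  obtain ⟨s₁, hs₁, hs₁1, hs₁ρ, hs₁κ⟩ := exists_recip_exponent hκ₂ h₁ h₂₁
  obtain ⟨s₂, hs₂, hs₂1, hs₂ρ, hs₂κ⟩ := exists_recip_exponent hκ₁ h₂ h₁₂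
  set σ₁ := ρ₁ - κ₁
  set σ₂ := ρ₂ - κ₂
  have hσ₁ : 0 < σ₁ := sub_pos.2 hκρ₁
  have hσ₂ : 0 < σ₂ := sub_pos.2 hκρ₂
  set δ := s₁ + s₂ - 1
  have hδ : 0 < δ := by simp only [δ]; linarith
  obtain ⟨c₁, hc₁, H₁⟩ := exists_le_moment_div (E := E) (s := s₁) (s' := 1 - s₂) (κ := κ₁) hα₁ hb₁
    (by linarith) (by linarith) (by rwa [← hρ₁]) hs₂κ (by rwa [← hρ₁])
  obtain ⟨c₂, hc₂, H₂⟩ := exists_le_moment_div (E := E) (s := s₂) (s' := 1 - s₁) (κ := κ₂) hα₂ hb₂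
    (by linarith) (by linarith) (by rwa [← hρ₂]) hs₁κ (by rwa [← hρ₂])
  obtain ⟨g₁, hg₁, G₁⟩ := exists_mul_recipNorm_schrodingerPropagator_le (E := E) hs₁.le hs₁1
  obtain ⟨g₂, hg₂, G₂⟩ := exists_mul_recipNorm_le_schrodingerPropagator (E := E) hs₂.le hs₂1
  rw [← hρ₁] at H₁
  rw [← hρ₂] at H₂
  refine ⟨c₁ ^ σ₂ * c₂ ^ σ₁ * (g₁ * g₂) ^ (σ₁ * σ₂ / δ), by positivity, fun u hu t ht x₀ x₁ => ?_⟩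
  have htpos : 0 < |t| := abs_pos.2 ht
  have hv := schrodingerPropagator_ne_zero t hu
  have F₁ := H₁ u hu x₀
  have F₂ := H₂ _ hv x₁
  have I₁ := G₁ t ht u
  have I₂ := G₂ t ht u
  set v := schrodingerPropagator E t u
  set d : ℝ := (Module.finrank ℝ E : ℝ)
  have p₁ := toReal_recipNorm_pos hu s₁
  have p₂ := toReal_recipNorm_pos hu (1 - s₂)
  have p₃ := toReal_recipNorm_pos hv s₂
  have p₄ := toReal_recipNorm_pos hv (1 - s₁)
  set a₁ := (recipNorm u s₁).toReal
  set a₂ := (recipNorm u (1 - s₂)).toReal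
  set a₃ := (recipNorm v s₂).toReal
  set a₄ := (recipNorm v (1 - s₁)).toReal
  have e₁ : s₁ - (1 - s₂) = δ := by simp only [δ]; ring
  have e₂ : s₂ - (1 - s₁) = δ := by simp only [δ]; ring
  rw [e₁] at F₁
  rw [e₂] at F₂
  refine le_trans ?_ (mul_le_mul' (ENNReal.rpow_le_rpow F₁ hσ₂.le)
    (ENNReal.rpow_le_rpow F₂ hσ₁.le))
  rw [ENNReal.ofReal_rpow_of_nonneg (by positivity) hσ₂.le,
    ENNReal.ofReal_rpow_of_nonneg (by positivity) hσ₁.le, ← ENNReal.ofReal_mul (by positivity)]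
  refine ENNReal.ofReal_le_ofReal ?_
  have hprod : g₁ * g₂ * |t| ^ (d * δ) ≤ a₁ / a₂ * (a₃ / a₄) := by
    rw [div_mul_div_comm, le_div_iff₀ (by positivity)]
    have e₃ : |t| ^ (d * δ) = |t| ^ (d * (s₁ - 1 / 2)) * |t| ^ (d * (s₂ - 1 / 2)) := by
      rw [← Real.rpow_add htpos]
      congr 1
      simp only [δ]; ring
    calc g₁ * g₂ * |t| ^ (d * δ) * (a₂ * a₄) =
        (g₁ * |t| ^ (d * (s₁ - 1 / 2)) * a₄) * (g₂ * |t| ^ (d * (s₂ - 1 / 2)) * a₂) := by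
          rw [e₃]; ring
      _ ≤ a₁ * a₃ := by gcongr
  have e₄ : |t| ^ (d * σ₁ * σ₂) = (|t| ^ (d * δ)) ^ (σ₁ * σ₂ / δ) := by
    rw [← Real.rpow_mul htpos.le]
    congr 1
    field_simp
  calc c₁ ^ σ₂ * c₂ ^ σ₁ * (g₁ * g₂) ^ (σ₁ * σ₂ / δ) * |t| ^ (d * σ₁ * σ₂)
      = c₁ ^ σ₂ * c₂ ^ σ₁ * (g₁ * g₂ * |t| ^ (d * δ)) ^ (σ₁ * σ₂ / δ) := by
        rw [e₄, Real.mul_rpow (x := g₁ * g₂) (by positivity) (by positivity)]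
        ring
    _ ≤ c₁ ^ σ₂ * c₂ ^ σ₁ * (a₁ / a₂ * (a₃ / a₄)) ^ (σ₁ * σ₂ / δ) := by gcongr
    _ = (c₁ * (a₁ / a₂) ^ (σ₁ / δ)) ^ σ₂ * (c₂ * (a₃ / a₄) ^ (σ₂ / δ)) ^ σ₁ := by
        rw [Real.mul_rpow (x := a₁ / a₂) (by positivity) (by positivity),
          Real.mul_rpow hc₁.le (by positivity), Real.mul_rpow hc₂.le (by positivity),
          ← Real.rpow_mul (by positivity), ← Real.rpow_mul (by positivity),
          show σ₁ / δ * σ₂ = σ₁ * σ₂ / δ by ring, show σ₂ / δ * σ₁ = σ₁ * σ₂ / δ by ring]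
        ring

/-- Growth of the moments of a fixed solution, in terms of reciprocal exponents. -/
theorem exists_le_moment_schrodingerPropagator [Nontrivial E] {α b ρ : ℝ} (hα : 0 ≤ α) (hb : 0 < b)
    (hρ : ρ = α + b / Module.finrank ℝ E) (h : 1 / 2 < ρ) {u : 𝓢(E, ℂ)} (hu : u ≠ 0) :
    ∃ C : ℝ, 0 < C ∧ ∀ t : ℝ, t ≠ 0 → ∀ x₀ : E,
      ENNReal.ofReal (C * |t| ^ (Module.finrank ℝ E * (ρ - 1 / 2))) ≤
        recipNorm (fun x => ((‖x - x₀‖ ^ b : ℝ) : ℂ) * schrodingerPropagator E t u x) α := by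
  obtain ⟨s, hs, hs1⟩ := exists_between (lt_min h (by norm_num : (1 / 2 : ℝ) < 1))
  obtain ⟨hsρ, hs1⟩ := lt_min_iff.1 hs1
  obtain ⟨c, hc, H⟩ := exists_le_moment_div (E := E) (s := s) (s' := 1 / 2) (κ := 1 / 2) hα hb
    (by norm_num) hs (by rwa [← hρ]) le_rfl (by rwa [← hρ])
  obtain ⟨g, hg, G⟩ := exists_mul_recipNorm_le_schrodingerPropagator (E := E) hs.le hs1.le
  rw [← hρ] at H
  set σ := ρ - 1 / 2
  have hσ : 0 < σ := sub_pos.2 h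
  set δ := s - 1 / 2
  have hδ : 0 < δ := sub_pos.2 hs
  have hK := toReal_recipNorm_pos hu (1 / 2)
  have hN := toReal_recipNorm_pos hu (1 - s)
  have hconv : (ENNReal.ofReal (1 / 2))⁻¹ = 2 := by
    rw [← ENNReal.ofReal_inv_of_pos (by norm_num)]; norm_num
  have hcons : ∀ t, recipNorm (schrodingerPropagator E t u) (1 / 2) = recipNorm u (1 / 2) := by
    intro t
    rw [recipNorm, recipNorm, hconv, eLpNorm_two_schrodingerPropagator]
  have hKe : recipNorm u (1 / 2) = ENNReal.ofReal (recipNorm u (1 / 2)).toReal :=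
    (ENNReal.ofReal_toReal (recipNorm_schwartz_ne_top u _)).symm
  set K := (recipNorm u (1 / 2)).toReal
  set N := (recipNorm u (1 - s)).toReal
  refine ⟨K * c * (g * N / K) ^ (σ / δ), by positivity, fun t ht x₀ => ?_⟩
  have htpos : 0 < |t| := abs_pos.2 ht
  have hv := schrodingerPropagator_ne_zero t hu
  have F := H _ hv x₀
  have I := G t ht u
  rw [hcons] at F
  have p := toReal_recipNorm_pos hv s
  set d : ℝ := (Module.finrank ℝ E : ℝ)
  rw [ENNReal.le_div_iff_mul_le (Or.inl (recipNorm_schwartz_ne_zero hu _))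
    (Or.inl (recipNorm_schwartz_ne_top u _)), hKe, ENNReal.toReal_ofReal hK.le, ← ENNReal.ofReal_mul (by positivity)] at F
  refine (ENNReal.ofReal_le_ofReal ?_).trans F
  have e₄ : |t| ^ (d * σ) = (|t| ^ (d * δ)) ^ (σ / δ) := by
    rw [← Real.rpow_mul htpos.le]
    congr 1
    field_simp
  calc K * c * (g * N / K) ^ (σ / δ) * |t| ^ (d * σ)
      = c * (g * |t| ^ (d * δ) * N / K) ^ (σ / δ) * K := by
        rw [e₄, show g * |t| ^ (d * δ) * N / K = g * N / K * |t| ^ (d * δ) by ring,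
          Real.mul_rpow (x := g * N / K) (by positivity) (by positivity)]
        ring
    _ ≤ c * ((recipNorm (schrodingerPropagator E t u) s).toReal / K) ^ (σ / δ) * K := by
        gcongr

end UncertaintyPrinciple

/-! ### Translation of the exponents -/

section Exponents

theorem schrodingerFlow_eq_schrodingerPropagator {n : ℕ} (t : ℝ)
    (u : 𝓢(EuclideanSpace ℝ (Fin n), ℂ)) :
    schrodingerFlow t u = schrodingerPropagator (EuclideanSpace ℝ (Fin n)) t u :=
  (schrodingerPropagator_apply t u).symm

theorem moment_eq_recipNorm {n : ℕ} {a : ℝ≥0∞} (ha : 0 < a) (b : ℝ)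
    (x₀ : EuclideanSpace ℝ (Fin n)) (f : EuclideanSpace ℝ (Fin n) → ℂ) :
    moment a b x₀ f = recipNorm (fun x => ((‖x - x₀‖ ^ b : ℝ) : ℂ) * f x) a⁻¹.toReal :=
  (recipNorm_inv_toReal _ ha.ne').symm

theorem critExponent_eq_ofReal_inv {n : ℕ} (hn : 0 < n) {a : ℝ≥0∞} (ha : 0 < a) {b : ℝ}
    (hb : 0 < b) : critExponent n a b = (ENNReal.ofReal (a⁻¹.toReal + b / n))⁻¹ := by
  have hn0 : (n : ℝ≥0∞) ≠ 0 := by exact_mod_cast hn.ne'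
  have hnt : (n : ℝ≥0∞) ≠ ∞ := ENNReal.natCast_ne_top n
  have hat : a⁻¹ ≠ ∞ := by simpa using ha.ne'
  have e1 : (n : ℝ≥0∞) / a + ENNReal.ofReal b =
      n * ENNReal.ofReal (a⁻¹.toReal + b / n) := by
    rw [ENNReal.ofReal_add (by positivity) (by positivity), ENNReal.ofReal_toReal hat, mul_add,
      ← div_eq_mul_inv, ENNReal.ofReal_div_of_pos (by exact_mod_cast hn), ENNReal.ofReal_natCast,
      ENNReal.mul_div_cancel hn0 hnt]
  rw [critExponent, e1, div_eq_mul_inv, ENNReal.mul_inv (Or.inl hn0) (Or.inl hnt), ← mul_assoc,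
    ENNReal.mul_inv_cancel hn0 hnt, one_mul]

theorem critExponent_lt_iff {n : ℕ} (hn : 0 < n) {a k : ℝ≥0∞} (ha : 0 < a) (hk : 0 < k) {b : ℝ}
    (hb : 0 < b) : critExponent n a b < k ↔ k⁻¹.toReal < a⁻¹.toReal + b / n := by
  have hkt : k⁻¹ ≠ ∞ := by simpa using hk.ne'
  rw [critExponent_eq_ofReal_inv hn ha hb, ← ENNReal.inv_lt_inv, inv_inv,
    ENNReal.lt_ofReal_iff_toReal_lt hkt]

/-- The condition `k < r'` whenever `1 ≤ r`, where `1 / r = ρ`, says `1 < 1 / k + ρ`. -/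
theorem one_lt_of_lt_conjExponent {n : ℕ} (hn : 0 < n) {a k : ℝ≥0∞} (ha : 0 < a) (hk : 0 < k)
    {b : ℝ} (hb : 0 < b)
    (h : 1 ≤ critExponent n a b → k < ENNReal.conjExponent (critExponent n a b)) :
    1 < k⁻¹.toReal + (a⁻¹.toReal + b / n) := by
  have hn' : (0 : ℝ) < n := by exact_mod_cast hn
  set ρ := a⁻¹.toReal + b / n with hρdef
  have hρ : 0 < ρ := by positivity
  have hkt : k⁻¹ ≠ ∞ := by simpa using hk.ne'
  rcases lt_or_ge 1 ρ with h1 | h1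
  · have : 0 ≤ k⁻¹.toReal := ENNReal.toReal_nonneg
    linarith
  set r := critExponent n a b with hr
  have hrρ : r⁻¹ = ENNReal.ofReal ρ := by
    rw [hr, critExponent_eq_ofReal_inv hn ha hb, inv_inv]
  have hr1 : 1 ≤ r := by
    rw [← ENNReal.inv_le_inv, hrρ, inv_one]
    exact ENNReal.ofReal_le_one.2 h1
  have hconj := ENNReal.HolderConjugate.conjExponent hr1
  have hsum := hconj.inv_add_inv_eq_one
  have hlt : (ENNReal.conjExponent r)⁻¹ < k⁻¹ := ENNReal.inv_lt_inv.2 (h hr1)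
  rw [hrρ] at hsum
  have hct : (ENNReal.conjExponent r)⁻¹ ≠ ∞ := hlt.ne_top
  have hlt' := (ENNReal.toReal_lt_toReal hct hkt).2 hlt
  have hsum' := congrArg ENNReal.toReal hsum
  rw [ENNReal.toReal_add ENNReal.ofReal_ne_top hct, ENNReal.toReal_ofReal hρ.le,
    ENNReal.toReal_one] at hsum'
  linarith

end Exponents

theorem theorem3 (n : ℕ) (hn : 0 < n) :
    (∀ (a₁ a₂ k₁ k₂ : ℝ≥0∞) (b₁ b₂ : ℝ),
      0 < a₁ → 0 < a₂ → 0 < k₁ → 0 < k₂ → 0 < b₁ → 0 < b₂ →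
      critExponent n a₁ b₁ < min 2 k₁ →
      critExponent n a₂ b₂ < min 2 k₂ →
      (1 ≤ critExponent n a₂ b₂ → k₁ < ENNReal.conjExponent (critExponent n a₂ b₂)) →
      (1 ≤ critExponent n a₁ b₁ → k₂ < ENNReal.conjExponent (critExponent n a₁ b₁)) →
      ∃ C : ℝ, 0 < C ∧
        ∀ u₀ : 𝓢(EuclideanSpace ℝ (Fin n), ℂ), u₀ ≠ 0 →
        ∀ t : ℝ, t ≠ 0 → ∀ x₀ x₁ : EuclideanSpace ℝ (Fin n),
          ENNReal.ofReal
              (C * |t| ^ ((n : ℝ) * momentGap n a₁ b₁ k₁ * momentGap n a₂ b₂ k₂)) ≤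
            (moment a₁ b₁ x₀ u₀ / eLpNorm u₀ k₁ volume) ^ momentGap n a₂ b₂ k₂ *
            (moment a₂ b₂ x₁ (schrodingerFlow t u₀) /
              eLpNorm (schrodingerFlow t u₀) k₂ volume) ^ momentGap n a₁ b₁ k₁) ∧
    (∀ (a : ℝ≥0∞) (b : ℝ), 0 < a → 0 < b → critExponent n a b < 2 →
      ∀ u₀ : 𝓢(EuclideanSpace ℝ (Fin n), ℂ), u₀ ≠ 0 →
      ∃ C : ℝ, 0 < C ∧
        ∀ t : ℝ, t ≠ 0 → ∀ x₀ : EuclideanSpace ℝ (Fin n),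
          ENNReal.ofReal (C * |t| ^ ((n : ℝ) * momentGap n a b 2)) ≤
            moment a b x₀ (schrodingerFlow t u₀)) := by
  have hfin : Module.finrank ℝ (EuclideanSpace ℝ (Fin n)) = n := finrank_euclideanSpace_fin
  have : Nontrivial (EuclideanSpace ℝ (Fin n)) :=
    Module.nontrivial_of_finrank_pos (R := ℝ) (by rw [hfin]; exact hn)
  have htwo : (2 : ℝ≥0∞)⁻¹.toReal = 1 / 2 := by simp
  refine ⟨?_, ?_⟩
  · intro a₁ a₂ k₁ k₂ b₁ b₂ ha₁ ha₂ hk₁ hk₂ hb₁ hb₂ h₁ h₂ h₁₂ h₂₁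
    obtain ⟨h₁, hκ₁⟩ := lt_min_iff.1 h₁
    obtain ⟨h₂, hκ₂⟩ := lt_min_iff.1 h₂
    rw [critExponent_lt_iff hn ha₁ (by norm_num) hb₁, htwo] at h₁
    rw [critExponent_lt_iff hn ha₂ (by norm_num) hb₂, htwo] at h₂
    rw [critExponent_lt_iff hn ha₁ hk₁ hb₁] at hκ₁
    rw [critExponent_lt_iff hn ha₂ hk₂ hb₂] at hκ₂
    obtain ⟨C, hC, H⟩ := exists_le_moment_div_rpow_mul (E := EuclideanSpace ℝ (Fin n))
      (α₁ := a₁⁻¹.toReal) (α₂ := a₂⁻¹.toReal) (κ₁ := k₁⁻¹.toReal) (κ₂ := k₂⁻¹.toReal)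
      ENNReal.toReal_nonneg ENNReal.toReal_nonneg ENNReal.toReal_nonneg ENNReal.toReal_nonneg
      hb₁ hb₂ (by rw [hfin]) (by rw [hfin]) h₁ h₂ hκ₁ hκ₂
      (one_lt_of_lt_conjExponent hn ha₂ hk₁ hb₂ h₁₂)
      (one_lt_of_lt_conjExponent hn ha₁ hk₂ hb₁ h₂₁)
    refine ⟨C, hC, fun u₀ hu t ht x₀ x₁ => ?_⟩
    have := H u₀ hu t ht x₀ x₁
    rwa [hfin, recipNorm_inv_toReal _ hk₁.ne', recipNorm_inv_toReal _ hk₂.ne',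
      ← moment_eq_recipNorm ha₁, ← moment_eq_recipNorm ha₂,
      ← schrodingerFlow_eq_schrodingerPropagator] at this
  · intro a b ha hb h u₀ hu
    rw [critExponent_lt_iff hn ha (by norm_num) hb, htwo] at h
    obtain ⟨C, hC, H⟩ := exists_le_moment_schrodingerPropagator
      (E := EuclideanSpace ℝ (Fin n)) (α := a⁻¹.toReal) ENNReal.toReal_nonneg hb
      (by rw [hfin]) h hu
    refine ⟨C, hC, fun t ht x₀ => ?_⟩
    have := H t ht x₀
    rwa [hfin, ← moment_eq_recipNorm ha, ← schrodingerFlow_eq_schrodingerPropagator,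
      ← htwo] at this
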